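/- Work in $V$, with elementary embeddings $j:V\to M$ into transitive classes $M\subseteq V$; $\operatorname{crit}(j)$ is the least ordinal moved by $j$. Let $\kappa$ be a cardinal and $\lambda\ge\kappa$ an ordinal. An embedding $j$ with $\operatorname{crit}(j)=\kappa$ and $j(\kappa)>\lambda$ has the *weak $\lambda$-covering property* if there is $s\in M$ with $j[\lambda]\subseteq s$ and $M\models|s|<j(\kappa)$. It has the *$\lambda$-covering property* if for every set $X\subseteq M$ with $|X|\le|\lambda|$ there is $s\in M$ with $X\subseteq s$ and $M\models |s|<j(\kappa)$; in that case it is called a *$\lambda$-strong compactness embedding*. - $\kappa$ is *$\lambda$-strongly compact* if some $j:V\to M$ with $\operatorname{crit}(j)=\kappa$ and $j(\kappa)>\lambda$ has the weak $\lambda$-covering property. - For a set of ordinals $A$, $\kappa$ is *$\lambda$-strongly compact for $A$* if there is a $\lambda$-strong compactness embedding $j:V\to M$ with $\operatorname{crit}(j)=\kappa$ and $A\cap\lambda=j(A)\cap\lambda$. - For a set $A$, $\kappa$ is *$\lambda$-strong for $A$* if there is $j:V\to M$ with $\operatorname{crit}(j)=\kappa$, $j(\kappa)>\lambda$, $V_\lambda\subseteq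 M$ and $A\cap V_\lambda=j(A)\cap V_\lambda$. - For a cardinal $\delta$, each of these properties *for ${<}\delta$* means that it holds for all ordinals $\lambda$ with $\kappa\le\lambda<\delta$. - For $A_1,A_2\subseteq\delta$, $\kappa$ is *${<}\delta$-strongly compact for $A_1\oplus A_2$* if for every ordinal $\lambda$ with $\kappa<\lambda<\delta$ there is a $\lambda$-strong compactness embedding $j:V\to M$ with $\operatorname{crit}(j)=\kappa$, $A_1\cap\lambda=j(A_1)\cap\lambda$ and $A_2\cap\lambda=j(A_2)\cap\lambda$. **Proposition.** Let $\delta$ be an infinite cardinal. The following are equivalent. 1. For every $A\subseteq\delta$ there is a cardinal $\kappa<\delta$ which is ${<}\delta$-strongly compact for $A$. 2. For all $A_1,A_2\subseteq\delta$ there is a cardinal $\kappa<\delta$ which is ${<}\delta$-strongly compact for $A_1\oplus A_2$. 3. For every $A\subseteq V_\delta$ there is a cardinal $\kappa<\delta$ which is both ${<}\delta$-strongly compact and ${<}\delta$-strong for $A$. -/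

import Mathlib

universe u

namespace WoodinSC

open scoped ZFSet

/-- The only non-logical symbol of the language of set theory: a binary relation symbol. -/
inductive SetRel : ℕ → Type
  | mem : SetRel 2

/-- The first-order language of set theory. -/
def setLang : FirstOrder.Language.{0, 0} where
  Functions := fun _ => Empty
  Relations := SetRel

/-- The universe of sets as a structure for the language of set theory. -/
instance universeStructure : setLang.Structure ZFSet.{u} where
  funMap := fun f _ => Empty.elim f
  RelMap := fun {_} r => match r with
    | SetRel.mem => fun x => x 0 ∈ x 1

/-- A class `M` as a structure for the language of set theory, with the true membership relation. -/
instance classStructure (M : Set ZFSet.{u}) : setLang.Structure M where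
  funMap := fun f _ => Empty.elim f
  RelMap := fun {_} r => match r with
    | SetRel.mem => fun x => (x 0 : ZFSet.{u}) ∈ (x 1 : ZFSet.{u})

/-- An elementary embedding `j : V → M`, where `V` is the universe of sets and `M ⊆ V` is a
transitive class. -/
structure UniverseEmbedding where
  /-- the target class -/
  M : Set ZFSet.{u}
  transitive : ∀ x ∈ M, ∀ y ∈ x, y ∈ M
  /-- the embedding, elementary for all formulas of the language of set theory -/
  emb : FirstOrder.Language.ElementaryEmbedding setLang ZFSet.{u} M

namespace UniverseEmbedding

/-- The value `j(x)` as a set. -/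
def app (j : UniverseEmbedding.{u}) (x : ZFSet.{u}) : ZFSet.{u} := (j.emb x : ZFSet.{u})

/-- `crit(j) = κ`: `κ` is the least ordinal moved by `j`. -/
def HasCrit (j : UniverseEmbedding.{u}) (κ : Ordinal.{u}) : Prop :=
  (∀ α < κ, j.app α.toZFSet = α.toZFSet) ∧ j.app κ.toZFSet ≠ κ.toZFSet

end UniverseEmbedding

/-- `M ⊨ |s| < θ`, for a transitive class `M` that is a model of ZFC, `s ∈ M` and a cardinal `θ`
of `M`: some `f ∈ M` is an injection from `s` into an element of the ordinal `θ`.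
(Being an injective function is absolute between `M` and `V`.) -/
def CardLTIn (M : Set ZFSet.{u}) (s θ : ZFSet.{u}) : Prop :=
  ∃ α ∈ θ, ∃ f ∈ M, ZFSet.IsFunc s α f ∧
    ∀ x y z : ZFSet.{u}, ZFSet.pair x z ∈ f → ZFSet.pair y z ∈ f → x = y

namespace UniverseEmbedding

/-- The weak `l`-covering property of `j` (with `crit(j) = κ`): there is `s ∈ M` with `j "l ⊆ s` and
`M ⊨ |s| < j(κ)`. -/
def WeakCovering (j : UniverseEmbedding.{u}) (κ l : Ordinal.{u}) : Prop :=
  ∃ s ∈ j.M, (∀ α < l, j.app α.toZFSet ∈ s) ∧ CardLTIn j.M s (j.app κ.toZFSet)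

/-- The `l`-covering property of `j` (with `crit(j) = κ`): every set `X ⊆ M` with `|X| ≤ l` is
covered by some `s ∈ M` with `M ⊨ |s| < j(κ)`. -/
def Covering (j : UniverseEmbedding.{u}) (κ l : Ordinal.{u}) : Prop :=
  ∀ X : ZFSet.{u}, (∀ x ∈ X, x ∈ j.M) → X.card ≤ l.card →
    ∃ s ∈ j.M, X ⊆ s ∧ CardLTIn j.M s (j.app κ.toZFSet)

/-- `j` is an `l`-strongness embedding with critical point `κ`:
`crit(j) = κ`, `j(κ) > l` and `V_l ⊆ M`. -/
def IsStrongness (j : UniverseEmbedding.{u}) (κ l : Ordinal.{u}) : Prop :=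
  j.HasCrit κ ∧ l.toZFSet ∈ j.app κ.toZFSet ∧ ∀ x ∈ V_ l, x ∈ j.M

/-- `j` is an `l`-strong compactness embedding with critical point `κ`:
`crit(j) = κ`, `j(κ) > l`, and `j` has the `l`-covering property. -/
def IsStrongCompactness (j : UniverseEmbedding.{u}) (κ l : Ordinal.{u}) : Prop :=
  j.HasCrit κ ∧ l.toZFSet ∈ j.app κ.toZFSet ∧ j.Covering κ l

end UniverseEmbedding

/-- `κ` is `l`-strong for the set `A`. -/
def IsStrongFor (κ : Cardinal.{u}) (l : Ordinal.{u}) (A : ZFSet.{u}) : Prop :=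
  ∃ j : UniverseEmbedding.{u}, j.IsStrongness κ.ord l ∧ A ∩ V_ l = j.app A ∩ V_ l

/-- `κ` is `l`-strongly compact. -/
def IsStronglyCompact (κ : Cardinal.{u}) (l : Ordinal.{u}) : Prop :=
  ∃ j : UniverseEmbedding.{u}, j.HasCrit κ.ord ∧ l.toZFSet ∈ j.app κ.ord.toZFSet ∧
    j.WeakCovering κ.ord l

/-- `κ` is `l`-strongly compact for the set of ordinals `A`. -/
def IsStronglyCompactFor (κ : Cardinal.{u}) (l : Ordinal.{u}) (A : ZFSet.{u}) : Prop :=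
  ∃ j : UniverseEmbedding.{u}, j.IsStrongCompactness κ.ord l ∧
    A ∩ l.toZFSet = j.app A ∩ l.toZFSet

/-- `κ` is `<δ`-strong for `A`. -/
def IsLTStrongFor (κ δ : Cardinal.{u}) (A : ZFSet.{u}) : Prop :=
  ∀ l : Ordinal.{u}, κ.ord ≤ l → l < δ.ord → IsStrongFor κ l A

/-- `κ` is `<δ`-strongly compact. -/
def IsLTStronglyCompact (κ δ : Cardinal.{u}) : Prop :=
  ∀ l : Ordinal.{u}, κ.ord ≤ l → l < δ.ord → IsStronglyCompact κ l

/-- `κ` is `<δ`-strongly compact for `A`. -/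
def IsLTStronglyCompactFor (κ δ : Cardinal.{u}) (A : ZFSet.{u}) : Prop :=
  ∀ l : Ordinal.{u}, κ.ord ≤ l → l < δ.ord → IsStronglyCompactFor κ l A

/-- `κ` is `<δ`-strongly compact for `A₁ ⊕ A₂`: for each `l ∈ (κ, δ)` a single embedding works for
both sets. -/
def IsLTStronglyCompactForPair (κ δ : Cardinal.{u}) (A₁ A₂ : ZFSet.{u}) : Prop :=
  ∀ l : Ordinal.{u}, κ.ord < l → l < δ.ord →
    ∃ j : UniverseEmbedding.{u}, j.IsStrongCompactness κ.ord l ∧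
      A₁ ∩ l.toZFSet = j.app A₁ ∩ l.toZFSet ∧ A₂ ∩ l.toZFSet = j.app A₂ ∩ l.toZFSet

end WoodinSC

/-! The implications run 1 → 3 → 2 → 1, and 2 → 1 only takes both sets equal.

For 1 → 3, membership on V_δ and the predicate A are coded by one set of ordinals. If j agrees with
this code far enough, ∈-induction shows that j of the coding function agrees with the coding
function on V_l (`pair_mem_app_codingGraph`). Hence V_l ⊆ M and j(A) agrees with A on V_l, so a
strong compactness embedding for the code is also a strongness embedding for A. Statement 1 applied
to single ordinals shows first that V_l has fewer than δ elements for l < δ, so codes stay below δ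
(`exists_card_vonNeumann_lt`).

For 3 → 2, let A be the tagged union of A₁ and A₂, let j be a strongness embedding for A and let i
have the weak covering property. Put k = j ∘ i. Since i fixes the elements of κ, a set B and i(B)
agree below κ, so j(B) and k(B) agree below j(κ) > l: k inherits its agreement from j. From i it
inherits the cover: if s covers i[l], then j(s) covers k[l]. Moreover j(κ) < k(κ), which leaves room
for all generators of a suitable target, and this upgrades weak covering to full covering
(`exists_isStrongCompactness`).

Target classes are arbitrary, so j cannot be applied to the target of i, and k is used only as a map
preserving absolute relations. That is enough: the values k(f ↾ D)(a), for a in a directed class of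
generators, form a hull. Separation for arbitrary predicates gives Łoś's theorem for every formula
(`realize_hull_iff`), and collapsing the hull yields a fully elementary embedding. -/

namespace WoodinSC

/-! ### Relations definable with bounded quantifiers -/

open scoped ZFSet
open FirstOrder Language

/-- The membership symbol. -/
abbrev memRel : setLang.Relations 2 := SetRel.mem

/-- `e` is, up to isomorphism, the inclusion of a transitive class into the universe of sets. -/
structure IsTransitiveInclusion {N : Type (u + 1)} [setLang.Structure N] (e : N → ZFSet.{u}) :
    Prop where
  injective : Function.Injective e
  relMap_iff : ∀ x : Fin 2 → N,
    Structure.RelMap memRel x ↔ e (x 0) ∈ e (x 1)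
  exists_eq : ∀ x, ∀ y ∈ e x, ∃ z, e z = y

theorem isTransitiveInclusion_id : IsTransitiveInclusion (id : ZFSet.{u} → ZFSet.{u}) :=
  ⟨Function.injective_id, fun _ => Iff.rfl, fun _ y _ => ⟨y, rfl⟩⟩

theorem isTransitiveInclusion_val {M : Set ZFSet.{u}} (hM : ∀ x ∈ M, ∀ y ∈ x, y ∈ M) :
    IsTransitiveInclusion (Subtype.val : M → ZFSet.{u}) :=
  ⟨Subtype.val_injective, fun _ => Iff.rfl, fun x y hy => ⟨⟨y, hM x x.2 y hy⟩, rfl⟩⟩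

/-- A relation on sets that is defined by one and the same formula in all transitive classes. -/
class IsAbsolute {ι : Type} (R : (ι → ZFSet.{u}) → Prop) : Prop where
  exists_formula : ∃ φ : setLang.Formula ι, ∀ {N : Type (u + 1)} [setLang.Structure N]
    (e : N → ZFSet.{u}), IsTransitiveInclusion e → ∀ v : ι → N, φ.Realize v ↔ R fun i => e (v i)

namespace IsAbsolute

variable {ι : Type}

instance mem (i j : ι) : IsAbsolute fun v : ι → ZFSet.{u} => v i ∈ v j := by
  refine ⟨Relations.formula₂ memRel (Term.var i) (Term.var j), ?_⟩
  intro N _ e he v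
  rw [Formula.realize_rel₂, he.relMap_iff]
  rfl

instance eq (i j : ι) : IsAbsolute fun v : ι → ZFSet.{u} => v i = v j := by
  refine ⟨Term.equal (L := setLang) (Term.var i) (Term.var j), ?_⟩
  intro N _ e he v
  rw [Formula.realize_equal, he.injective.eq_iff]
  rfl

instance not (P : (ι → ZFSet.{u}) → Prop) [hP : IsAbsolute P] : IsAbsolute fun v => ¬ P v := by
  obtain ⟨φ, hφ⟩ := hP
  exact ⟨φ.not, fun e he v => by rw [Formula.realize_not, hφ e he]⟩

instance and (P Q : (ι → ZFSet.{u}) → Prop) [hP : IsAbsolute P] [hQ : IsAbsolute Q] :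
    IsAbsolute fun v => P v ∧ Q v := by
  obtain ⟨φ, hφ⟩ := hP
  obtain ⟨ψ, hψ⟩ := hQ
  exact ⟨φ ⊓ ψ, fun e he v => by rw [Formula.realize_inf, hφ e he, hψ e he]⟩

theorem congr {P Q : (ι → ZFSet.{u}) → Prop} (hP : IsAbsolute P) (h : ∀ v, P v ↔ Q v) :
    IsAbsolute Q := by
  obtain rfl : P = Q := funext fun v => propext (h v)
  exact hP

instance imp (P Q : (ι → ZFSet.{u}) → Prop) [hP : IsAbsolute P] [hQ : IsAbsolute Q] :
    IsAbsolute fun v => P v → Q v :=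
  congr (P := fun v => ¬ (P v ∧ ¬ Q v)) inferInstance fun _ => by tauto

instance or (P Q : (ι → ZFSet.{u}) → Prop) [hP : IsAbsolute P] [hQ : IsAbsolute Q] :
    IsAbsolute fun v => P v ∨ Q v :=
  congr (P := fun v => ¬ (¬ P v ∧ ¬ Q v)) inferInstance fun _ => by tauto

instance iff (P Q : (ι → ZFSet.{u}) → Prop) [hP : IsAbsolute P] [hQ : IsAbsolute Q] :
    IsAbsolute fun v => P v ↔ Q v :=
  congr (P := fun v => (P v → Q v) ∧ (Q v → P v)) inferInstance fun _ => by tauto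

instance bex (i : ι) (Q : (ι → ZFSet.{u}) → ZFSet.{u} → Prop)
    [hQ : IsAbsolute fun w : Option ι → ZFSet.{u} => Q (fun k => w (some k)) (w none)] :
    IsAbsolute fun v => ∃ y, y ∈ v i ∧ Q v y := by
  have h : IsAbsolute fun w : Option ι → ZFSet.{u} =>
    w none ∈ w (some i) ∧ Q (fun k => w (some k)) (w none) := inferInstance
  obtain ⟨φ, hφ⟩ := h
  refine ⟨Formula.iExs Unit (φ.relabel fun o : Option ι => o.elim (Sum.inr ()) Sum.inl), ?_⟩
  intro N _ e he v
  rw [Formula.realize_iExs]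
  simp only [Formula.realize_relabel, hφ e he, Function.comp_def]
  constructor
  · rintro ⟨w, h⟩
    exact ⟨_, h⟩
  · rintro ⟨y, hy, h⟩
    -- Transitivity enters here: a witness below `v i` already lies in `N`.
    obtain ⟨z, rfl⟩ := he.exists_eq _ _ hy
    exact ⟨fun _ => z, hy, h⟩

instance ball (i : ι) (Q : (ι → ZFSet.{u}) → ZFSet.{u} → Prop)
    [hQ : IsAbsolute fun w : Option ι → ZFSet.{u} => Q (fun k => w (some k)) (w none)] :
    IsAbsolute fun v => ∀ y, y ∈ v i → Q v y :=
  congr (P := fun v => ¬ ∃ y, y ∈ v i ∧ ¬ Q v y) inferInstance fun _ => by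
    push Not; rfl

instance subset (i j : ι) : IsAbsolute fun v : ι → ZFSet.{u} => v i ⊆ v j :=
  congr (P := fun v : ι → ZFSet.{u} => ∀ y, y ∈ v i → y ∈ v j) inferInstance
    fun _ => Iff.rfl

/-- The Kuratowski pair unfolded into bounded quantifiers, the form from which instance search can
build an absolute formula. -/
theorem eq_pair_iff (x y z : ZFSet.{u}) : x = ZFSet.pair y z ↔
    (∀ p, p ∈ x → (y ∈ p ∧ ((∀ a, a ∈ p → a = y) ∨ (z ∈ p ∧ ∀ a, a ∈ p → a = y ∨ a = z)))) ∧
    (∃ p, p ∈ x ∧ (y ∈ p ∧ ∀ a, a ∈ p → a = y)) ∧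
    (∃ p, p ∈ x ∧ (y ∈ p ∧ z ∈ p ∧ ∀ a, a ∈ p → a = y ∨ a = z)) := by
  have e1 : ∀ p : ZFSet.{u}, p = {y} ↔ y ∈ p ∧ ∀ a, a ∈ p → a = y := by
    intro p
    constructor
    · rintro rfl; simp
    · rintro ⟨h, h'⟩; ext a; rw [ZFSet.mem_singleton]; exact ⟨h' a, by rintro rfl; exact h⟩
  have e2 : ∀ p : ZFSet.{u}, p = {y, z} ↔ y ∈ p ∧ z ∈ p ∧ ∀ a, a ∈ p → a = y ∨ a = z := by
    intro p
    constructor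
    · rintro rfl; simp
    · rintro ⟨h, h', h''⟩
      ext a; rw [ZFSet.mem_pair]; exact ⟨h'' a, by rintro (rfl | rfl) <;> assumption⟩
  simp_rw [and_or_left, ← e1, ← e2]
  constructor
  · rintro rfl; simp [ZFSet.pair]
  · rintro ⟨h, ⟨p, hp, rfl⟩, ⟨q, hq, rfl⟩⟩
    ext a; rw [ZFSet.pair, ZFSet.mem_pair]
    exact ⟨h a, by rintro (rfl | rfl) <;> assumption⟩

instance eq_pair (i j k : ι) : IsAbsolute fun v : ι → ZFSet.{u} => v i = ZFSet.pair (v j) (v k) :=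
  congr (P := fun v : ι → ZFSet.{u} =>
    (∀ p, p ∈ v i → (v j ∈ p ∧ ((∀ a, a ∈ p → a = v j) ∨
      (v k ∈ p ∧ ∀ a, a ∈ p → a = v j ∨ a = v k)))) ∧
    (∃ p, p ∈ v i ∧ (v j ∈ p ∧ ∀ a, a ∈ p → a = v j)) ∧
    (∃ p, p ∈ v i ∧ (v j ∈ p ∧ v k ∈ p ∧ ∀ a, a ∈ p → a = v j ∨ a = v k))) inferInstance
    fun _ => (eq_pair_iff _ _ _).symm

instance pair_mem (i j k : ι) :
    IsAbsolute fun v : ι → ZFSet.{u} => ZFSet.pair (v i) (v j) ∈ v k :=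
  congr (P := fun v : ι → ZFSet.{u} => ∃ p, p ∈ v k ∧ p = ZFSet.pair (v i) (v j)) inferInstance
    fun _ => by simp

instance ex_pair (i : ι) (Q : (ι → ZFSet.{u}) → ZFSet.{u} → ZFSet.{u} → Prop)
    [hQ : IsAbsolute fun w : Option (Option (Option ι)) → ZFSet.{u} =>
      Q (fun k => w (some (some (some k)))) (w (some none)) (w none)] :
    IsAbsolute fun v => ∃ x y, v i = ZFSet.pair x y ∧ Q v x y :=
  congr (P := fun v : ι → ZFSet.{u} =>
    ∃ p, p ∈ v i ∧ ∃ x, x ∈ p ∧ ∃ y, y ∈ p ∧ v i = ZFSet.pair x y ∧ Q v x y) inferInstance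
    fun v => by
      constructor
      · rintro ⟨p, -, x, -, y, -, h⟩; exact ⟨x, y, h⟩
      · rintro ⟨x, y, h, h'⟩
        exact ⟨{x, y}, by rw [h]; simp [ZFSet.pair], x, by simp, y, by simp, h, h'⟩

instance all_pair (i : ι) (Q : (ι → ZFSet.{u}) → ZFSet.{u} → ZFSet.{u} → Prop)
    [hQ : IsAbsolute fun w : Option (Option (Option ι)) → ZFSet.{u} =>
      Q (fun k => w (some (some (some k)))) (w (some none)) (w none)] :
    IsAbsolute fun v => ∀ x y, v i = ZFSet.pair x y → Q v x y :=
  congr (P := fun v : ι → ZFSet.{u} => ¬ ∃ x y, v i = ZFSet.pair x y ∧ ¬ Q v x y) inferInstance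
    fun v => by push Not; rfl

instance ex_pair_mem (i : ι) (Q : (ι → ZFSet.{u}) → ZFSet.{u} → ZFSet.{u} → Prop)
    [hQ : IsAbsolute fun w : Option (Option (Option (Option ι))) → ZFSet.{u} =>
      Q (fun k => w (some (some (some (some k))))) (w (some none)) (w none)] :
    IsAbsolute fun v => ∃ x y, ZFSet.pair x y ∈ v i ∧ Q v x y :=
  congr (P := fun v : ι → ZFSet.{u} => ∃ p, p ∈ v i ∧ ∃ x y, p = ZFSet.pair x y ∧ Q v x y)
    inferInstance fun v => by simp

instance all_pair_mem (i : ι) (Q : (ι → ZFSet.{u}) → ZFSet.{u} → ZFSet.{u} → Prop)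
    [hQ : IsAbsolute fun w : Option (Option (Option (Option ι))) → ZFSet.{u} =>
      Q (fun k => w (some (some (some (some k))))) (w (some none)) (w none)] :
    IsAbsolute fun v => ∀ x y, ZFSet.pair x y ∈ v i → Q v x y :=
  congr (P := fun v : ι → ZFSet.{u} => ¬ ∃ x y, ZFSet.pair x y ∈ v i ∧ ¬ Q v x y) inferInstance
    fun v => by push Not; rfl

instance pair_pair_mem (i j k l : ι) :
    IsAbsolute fun v : ι → ZFSet.{u} => ZFSet.pair (ZFSet.pair (v i) (v j)) (v k) ∈ v l :=
  congr (P := fun v : ι → ZFSet.{u} =>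
    ∃ x y, ZFSet.pair x y ∈ v l ∧ (x = ZFSet.pair (v i) (v j) ∧ y = v k)) inferInstance
    fun v => by simp

instance isFunc (i j k : ι) : IsAbsolute fun v : ι → ZFSet.{u} => ZFSet.IsFunc (v i) (v j) (v k) :=
  congr (P := fun v : ι → ZFSet.{u} => (∀ p, p ∈ v k → ∃ x y, p = ZFSet.pair x y ∧
      (x ∈ v i ∧ y ∈ v j)) ∧
    ∀ x, x ∈ v i → ∃ y, y ∈ v j ∧ (ZFSet.pair x y ∈ v k ∧
      ∀ z, z ∈ v j → ZFSet.pair x z ∈ v k → z = y)) inferInstance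
    fun v => by
      constructor
      · rintro ⟨h₁, h₂⟩
        refine ⟨fun p hp => ?_, fun x hx => ?_⟩
        · obtain ⟨x, y, rfl, hx, hy⟩ := h₁ p hp
          exact ZFSet.pair_mem_prod.2 ⟨hx, hy⟩
        · obtain ⟨y, -, hxy, h⟩ := h₂ x hx
          refine ⟨y, hxy, fun z hz => ?_⟩
          obtain ⟨_, _, e, -, hz'⟩ := h₁ _ hz
          obtain ⟨rfl, rfl⟩ := ZFSet.pair_inj.1 e
          exact h z hz' hz
      · rintro ⟨h₁, h₂⟩
        refine ⟨fun p hp => ?_, fun x hx => ?_⟩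
        · obtain ⟨x, hx, y, hy, rfl⟩ := ZFSet.mem_prod.1 (h₁ hp)
          exact ⟨x, y, rfl, hx, hy⟩
        · obtain ⟨y, hxy, h⟩ := h₂ x hx
          exact ⟨y, (ZFSet.pair_mem_prod.1 (h₁ hxy)).2, hxy, fun z _ hz => h z hz⟩

theorem comp {κ : Type} {R : (κ → ZFSet.{u}) → Prop} (hR : IsAbsolute R) (σ : κ → ι) :
    IsAbsolute fun v : ι → ZFSet.{u} => R fun k => v (σ k) := by
  obtain ⟨φ, hφ⟩ := hR
  refine ⟨φ.relabel σ, ?_⟩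
  intro N _ e he v
  rw [Formula.realize_relabel, hφ e he]
  rfl

end IsAbsolute

end WoodinSC

/-! ### Derived ultrafilters and extended functions -/

namespace WoodinSC

open scoped ZFSet
open FirstOrder Language

/-- A map from sets to sets that preserves and reflects all absolute relations. -/
structure PreservesAbsolute (k : ZFSet.{u} → ZFSet.{u}) : Prop where
  iff : ∀ {n : ℕ} (v : Fin n → ZFSet.{u}) (R : (Fin n → ZFSet.{u}) → Prop) [IsAbsolute R],
    R (fun i => k (v i)) ↔ R v

namespace UniverseEmbedding

variable (j : UniverseEmbedding.{u})

theorem app_mem (x : ZFSet.{u}) : j.app x ∈ j.M := (j.emb x).2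

theorem preservesAbsolute : PreservesAbsolute j.app := by
  refine ⟨fun v R hR => ?_⟩
  obtain ⟨φ, hφ⟩ := hR
  have h₁ := hφ _ isTransitiveInclusion_id v
  have h₂ := hφ _ (isTransitiveInclusion_val j.transitive) (j.emb ∘ v)
  rw [j.emb.map_formula] at h₂
  exact h₂.symm.trans h₁

/-- Elementarity for a universal statement. It says more than preservation of absolute relations,
because `w` ranges over arbitrary elements of the target and not only over values of j. -/
theorem forall_mem_of_forall {n m : ℕ} (R : (Fin n ⊕ Fin m → ZFSet.{u}) → Prop) [hR : IsAbsolute R]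
    (v : Fin n → ZFSet.{u}) (h : ∀ w, R (Sum.elim v w)) (w : Fin m → ZFSet.{u})
    (hw : ∀ i, w i ∈ j.M) : R (Sum.elim (fun i => j.app (v i)) w) := by
  obtain ⟨φ, hφ⟩ := hR
  have h₁ : (φ.iAlls (Fin m)).Realize v := by
    rw [Formula.realize_iAlls]
    intro w
    exact (hφ _ isTransitiveInclusion_id _).2 (h w)
  rw [← j.emb.map_formula, Formula.realize_iAlls] at h₁
  have h₂ := (hφ _ (isTransitiveInclusion_val j.transitive) _).1 (h₁ fun i => ⟨w i, hw i⟩)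
  convert h₂ using 1
  ext i
  cases i <;> rfl

end UniverseEmbedding

/-- The graph of `f` restricted to the set `D`, as a set. -/
noncomputable def graph (f : ZFSet.{u} → ZFSet.{u}) (D : ZFSet.{u}) : ZFSet.{u} :=
  ZFSet.range fun d : D => ZFSet.pair d (f d)

/-- The image of the set `D` under `f`. -/
noncomputable def setImage (f : ZFSet.{u} → ZFSet.{u}) (D : ZFSet.{u}) : ZFSet.{u} :=
  ZFSet.range fun d : D => f d

theorem pair_mem_graph {f : ZFSet.{u} → ZFSet.{u}} {D x y : ZFSet.{u}} :
    ZFSet.pair x y ∈ graph f D ↔ x ∈ D ∧ f x = y := by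
  simp only [graph, ZFSet.mem_range, ZFSet.pair_inj, Subtype.exists]
  constructor
  · rintro ⟨d, hd, rfl, rfl⟩; exact ⟨hd, rfl⟩
  · rintro ⟨hd, rfl⟩; exact ⟨x, hd, rfl, rfl⟩

theorem mem_setImage {f : ZFSet.{u} → ZFSet.{u}} {D y : ZFSet.{u}} :
    y ∈ setImage f D ↔ ∃ x ∈ D, f x = y := by
  simp [setImage, ZFSet.mem_range]

namespace PreservesAbsolute

variable {k : ZFSet.{u} → ZFSet.{u}} (hk : PreservesAbsolute k)
include hk

theorem comp {k' : ZFSet.{u} → ZFSet.{u}} (hk' : PreservesAbsolute k') :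
    PreservesAbsolute (k ∘ k') :=
  ⟨fun v R _ => (hk.iff (fun i => k' (v i)) R).trans (hk'.iff v R)⟩

theorem mem_iff {x y : ZFSet.{u}} : k x ∈ k y ↔ x ∈ y := hk.iff ![x, y] (fun v => v 0 ∈ v 1)

theorem subset_iff {x y : ZFSet.{u}} : k x ⊆ k y ↔ x ⊆ y := hk.iff ![x, y] (fun v => v 0 ⊆ v 1)

theorem map_pair (x y : ZFSet.{u}) : k (ZFSet.pair x y) = ZFSet.pair (k x) (k y) :=
  (hk.iff ![ZFSet.pair x y, x, y] (fun v => v 0 = ZFSet.pair (v 1) (v 2))).2 rfl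

theorem map_empty : k ∅ = ∅ := by
  rw [ZFSet.eq_empty]
  intro y hy
  exact (hk.iff ![∅] (fun v => ∀ y ∈ v 0, ¬ v 0 = v 0)).2 (by simp) y hy rfl

theorem mem_inter_iff {x y z : ZFSet.{u}} : z ∈ k (x ∩ y) ↔ z ∈ k x ∧ z ∈ k y := by
  have h := (hk.iff ![x ∩ y, x, y]
    (fun v => (∀ z ∈ v 0, z ∈ v 1 ∧ z ∈ v 2) ∧ ∀ z ∈ v 1, z ∈ v 2 → z ∈ v 0)).2 ⟨fun z hz => ZFSet.mem_inter.1 hz, fun z h h' => ZFSet.mem_inter.2 ⟨h, h'⟩⟩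
  exact ⟨h.1 z, fun hz => h.2 z hz.1 hz.2⟩

theorem mem_union_iff {x y z : ZFSet.{u}} : z ∈ k (x ∪ y) ↔ z ∈ k x ∨ z ∈ k y := by
  have h := (hk.iff ![x ∪ y, x, y]
    (fun v => (∀ z ∈ v 0, z ∈ v 1 ∨ z ∈ v 2) ∧ (∀ z ∈ v 1, z ∈ v 0) ∧
    ∀ z ∈ v 2, z ∈ v 0)).2 ⟨fun z hz => ZFSet.mem_union.1 hz, fun z h => ZFSet.mem_union.2 (.inl h),
      fun z h => ZFSet.mem_union.2 (.inr h)⟩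
  exact ⟨h.1 z, fun hz => hz.elim (h.2.1 z) (h.2.2 z)⟩

theorem mem_sdiff_iff {x y z : ZFSet.{u}} : z ∈ k (x \ y) ↔ z ∈ k x ∧ z ∉ k y := by
  have h := (hk.iff ![x \ y, x, y]
    (fun v => (∀ z ∈ v 0, z ∈ v 1 ∧ ¬ z ∈ v 2) ∧ ∀ z ∈ v 1, ¬ z ∈ v 2 → z ∈ v 0)).2 ⟨fun z hz => ZFSet.mem_sdiff.1 hz, fun z h h' => ZFSet.mem_sdiff.2 ⟨h, h'⟩⟩
  exact ⟨h.1 z, fun hz => h.2 z hz.1 hz.2⟩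

theorem isTransitive {x : ZFSet.{u}} (hx : x.IsTransitive) : (k x).IsTransitive :=
  (hk.iff ![x] (fun v => ∀ y ∈ v 0, y ⊆ v 0)).2 hx

theorem isOrdinal {x : ZFSet.{u}} (hx : x.IsOrdinal) : (k x).IsOrdinal := by
  rw [ZFSet.isOrdinal_iff_forall_mem_isTransitive] at hx ⊢
  exact ⟨hk.isTransitive hx.1, (hk.iff ![x] (fun v => ∀ y ∈ v 0, ∀ z ∈ y, z ⊆ y)).2 hx.2⟩

theorem pair_mem_prod_iff {x y a b : ZFSet.{u}} :
    ZFSet.pair a b ∈ k (ZFSet.prod x y) ↔ a ∈ k x ∧ b ∈ k y := by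
  have h := (hk.iff ![x.prod y, x, y] (fun v => (∀ a b, ZFSet.pair a b ∈ v 0 → a ∈ v 1 ∧ b ∈ v 2) ∧
    ∀ a ∈ v 1, ∀ b ∈ v 2, ZFSet.pair a b ∈ v 0)).2
    ⟨fun a b h => ZFSet.pair_mem_prod.1 h, fun a ha b hb => ZFSet.pair_mem_prod.2 ⟨ha, hb⟩⟩
  exact ⟨h.1 a b, fun h' => h.2 a h'.1 b h'.2⟩

omit hk in
/-- The property `P` holds at `a` in the sense of the extension `k`. -/
def Ev (k : ZFSet.{u} → ZFSet.{u}) (a : ZFSet.{u}) (P : ZFSet.{u} → Prop) : Prop :=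
  ∃ D, a ∈ k (ZFSet.sep P D)

theorem Ev.mono {a : ZFSet.{u}} {P Q : ZFSet.{u} → Prop} (h : Ev k a P) (hPQ : ∀ x, P x → Q x) :
    Ev k a Q := by
  obtain ⟨D, hD⟩ := h
  refine ⟨D, hk.subset_iff.2 (fun x hx => ?_) hD⟩
  rw [ZFSet.mem_sep] at hx ⊢
  exact ⟨hx.1, hPQ x hx.2⟩

theorem Ev.and {a : ZFSet.{u}} {P Q : ZFSet.{u} → Prop} (h : Ev k a P) (h' : Ev k a Q) :
    Ev k a fun x => P x ∧ Q x := by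
  obtain ⟨D, hD⟩ := h
  obtain ⟨E, hE⟩ := h'
  refine ⟨D, hk.subset_iff.2 (fun x hx => ?_) (hk.mem_inter_iff.2 ⟨hD, hE⟩)⟩
  simp only [ZFSet.mem_sep, ZFSet.mem_inter] at hx ⊢
  exact ⟨hx.1.1, hx.1.2, hx.2.2⟩

/-- The predicates P with `Ev k a P` form an ultrafilter. It decides every predicate, definable or
not, because separation is available for all of them and k respects set difference. -/
theorem Ev.not {a : ZFSet.{u}} {P : ZFSet.{u} → Prop} (ha : ∃ D, a ∈ k D) :
    Ev k a (fun x => ¬ P x) ↔ ¬ Ev k a P := by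
  constructor
  · intro h h'
    obtain ⟨D, hD⟩ := Ev.and hk h h'
    have : ZFSet.sep (fun x => ¬ P x ∧ P x) D = ∅ := by
      rw [ZFSet.eq_empty]; simp
    rw [this, hk.map_empty] at hD
    exact ZFSet.notMem_empty _ hD
  · intro h
    obtain ⟨D, hD⟩ := ha
    refine ⟨D, ?_⟩
    have : ZFSet.sep (fun x => ¬ P x) D = D \ ZFSet.sep P D := by
      ext; simp only [ZFSet.mem_sep, ZFSet.mem_sdiff]; tauto
    rw [this, hk.mem_sdiff_iff]
    exact ⟨hD, fun h' => h ⟨D, h'⟩⟩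

theorem Ev.of_forall {a : ZFSet.{u}} {P : ZFSet.{u} → Prop} (ha : ∃ D, a ∈ k D) (h : ∀ x, P x) :
    Ev k a P := by
  by_contra h'
  rw [← Ev.not hk ha] at h'
  exact (Ev.not hk ha).1 h' (Ev.mono hk h' fun x hx => (hx (h x)).elim)

theorem Ev.const_iff {a : ZFSet.{u}} (ha : ∃ D, a ∈ k D) (p : Prop) :
    Ev k a (fun _ => p) ↔ p := by
  by_cases hp : p
  · simpa [hp] using Ev.of_forall hk ha fun _ => trivial
  · simpa [hp] using (Ev.not hk ha (P := fun _ => True)).1.mt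
      (not_not.2 (Ev.of_forall hk ha fun _ => trivial))

omit hk in
open Classical in
/-- The value at `a` of the extension of `f` along `k`. -/
noncomputable def ap (k f : ZFSet.{u} → ZFSet.{u}) (a : ZFSet.{u}) : ZFSet.{u} :=
  if h : ∃ x D, ZFSet.pair a x ∈ k (graph f D) then h.choose else ∅

theorem pair_ap_mem {f : ZFSet.{u} → ZFSet.{u}} {a D : ZFSet.{u}} (ha : a ∈ k D) :
    ZFSet.pair a (ap k f a) ∈ k (graph f D) := by
  have key : ∀ E, a ∈ k E → ∃ x, ZFSet.pair a x ∈ k (graph f E) := by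
    intro E hE
    -- The image set is a parameter only to bound the quantifier over values.
    have := (hk.iff ![E, graph f E, setImage f E]
      (fun v => ∀ d ∈ v 0, ∃ y ∈ v 2, ZFSet.pair d y ∈ v 1)).2 (fun d hd => ⟨f d, mem_setImage.2 ⟨d, hd, rfl⟩,
        pair_mem_graph.2 ⟨hd, rfl⟩⟩) a hE
    obtain ⟨y, -, hy⟩ := this
    exact ⟨y, hy⟩
  have h : ∃ x D, ZFSet.pair a x ∈ k (graph f D) :=
    let ⟨x, hx⟩ := key D ha; ⟨x, D, hx⟩
  have hap : ap k f a = h.choose := dif_pos h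
  obtain ⟨E, hE⟩ := h.choose_spec
  rw [← hap] at hE
  obtain ⟨x, hx⟩ := key D ha
  have huniq := (hk.iff ![graph f D, graph f E, setImage f E] (fun v => ∀ d x, ZFSet.pair d x ∈ v 0 → ∀ y, y ∈ v 2 →
    ZFSet.pair d y ∈ v 1 → x = y)).2
    (fun d x h y _ h' => (pair_mem_graph.1 h).2.symm.trans (pair_mem_graph.1 h').2) a x hx
    (ap k f a) ?_ hE
  · rwa [← huniq]
  · exact (hk.iff ![graph f E, setImage f E] (fun v => ∀ d x, ZFSet.pair d x ∈ v 0 → x ∈ v 1)).2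
      (fun d x h => mem_setImage.2 ⟨d, pair_mem_graph.1 h⟩) a _ hE

theorem ap_mem {f : ZFSet.{u} → ZFSet.{u}} {a D : ZFSet.{u}} (ha : a ∈ k D) :
    ap k f a ∈ k (setImage f D) :=
  (hk.iff ![graph f D, setImage f D] (fun v => ∀ d x, ZFSet.pair d x ∈ v 0 → x ∈ v 1)).2
      (fun d _ h => mem_setImage.2 ⟨d, pair_mem_graph.1 h⟩) a _ (hk.pair_ap_mem ha)

theorem ap_exists_mem {f : ZFSet.{u} → ZFSet.{u}} {a : ZFSet.{u}} (ha : ∃ D, a ∈ k D) :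
    ∃ D, ap k f a ∈ k D :=
  ha.imp' (setImage f) fun _ h => hk.ap_mem h

theorem ev_ap_iff {f : ZFSet.{u} → ZFSet.{u}} {P : ZFSet.{u} → Prop} {a : ZFSet.{u}}
    (ha : ∃ D, a ∈ k D) : Ev k (ap k f a) P ↔ Ev k a fun x => P (f x) := by
  have key : ∀ Q : ZFSet.{u} → Prop, Ev k a (fun x => Q (f x)) → Ev k (ap k f a) Q := by
    rintro Q ⟨D, hD⟩
    refine ⟨setImage f (ZFSet.sep (fun x => Q (f x)) D), ?_⟩
    convert hk.ap_mem (f := f) hD using 2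
    ext y
    rw [ZFSet.mem_sep, mem_setImage, and_iff_left_iff_imp]
    rintro ⟨x, hx, rfl⟩
    exact (ZFSet.mem_sep.1 hx).2
  refine ⟨fun h => ?_, key P⟩
  by_contra h'
  rw [← Ev.not hk ha] at h'
  exact (Ev.not hk (hk.ap_exists_mem ha)).1 (key _ h') h

/-- Łoś's theorem for absolute relations, before any hull is formed: apply k to the graphs of the
functions on a set where R holds pointwise. Three places suffice for pairing; unused places are
filled arbitrarily. -/
theorem rel_ap {f g h : ZFSet.{u} → ZFSet.{u}} {a : ZFSet.{u}} (R : (Fin 3 → ZFSet.{u}) → Prop)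
    [hR : IsAbsolute R] (ha : Ev k a fun x => R ![f x, g x, h x]) :
    R ![ap k f a, ap k g a, ap k h a] := by
  obtain ⟨D, hD⟩ := ha
  set E := ZFSet.sep (fun x => R ![f x, g x, h x]) D with hE
  have {ι : Type} (i₀ i₁ i₂ : ι) :
      IsAbsolute fun v : ι → ZFSet.{u} => R ![v i₀, v i₁, v i₂] := by
    refine (hR.comp ![i₀, i₁, i₂]).congr fun v => iff_of_eq (congrArg R ?_)
    ext i; fin_cases i <;> rfl
  -- The equations between the dᵢ and d replace shared variables, since quantification over pairs in
  -- a set binds both components.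
  exact (hk.iff ![E, graph f E, graph g E, graph h E] (fun v => ∀ d ∈ v 0, ∀ d₁ x, ZFSet.pair d₁ x ∈ v 1 →
    ∀ d₂ y, ZFSet.pair d₂ y ∈ v 2 → ∀ d₃ z, ZFSet.pair d₃ z ∈ v 3 →
    d₁ = d → d₂ = d → d₃ = d → R ![x, y, z])).2
    (by
      rintro d hd d₁ x hx d₂ y hy d₃ z hz rfl rfl rfl
      rw [← (pair_mem_graph.1 hx).2, ← (pair_mem_graph.1 hy).2, ← (pair_mem_graph.1 hz).2]
      exact (ZFSet.mem_sep.1 (show d₃ ∈ E from hd)).2)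
    a hD a _ (hk.pair_ap_mem hD) a _ (hk.pair_ap_mem hD) a _ (hk.pair_ap_mem hD) rfl rfl rfl

theorem ap_mem_ap_iff {f g : ZFSet.{u} → ZFSet.{u}} {a : ZFSet.{u}} (ha : ∃ D, a ∈ k D) :
    ap k f a ∈ ap k g a ↔ Ev k a fun x => f x ∈ g x := by
  refine ⟨fun h => ?_, fun h => hk.rel_ap (h := f) (fun v => v 0 ∈ v 1) h⟩
  by_contra h'
  rw [← Ev.not hk ha] at h'
  exact hk.rel_ap (h := f) (fun v => ¬ v 0 ∈ v 1) h' h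

theorem ap_eq_ap_iff {f g : ZFSet.{u} → ZFSet.{u}} {a : ZFSet.{u}} (ha : ∃ D, a ∈ k D) :
    ap k f a = ap k g a ↔ Ev k a fun x => f x = g x := by
  refine ⟨fun h => ?_, fun h => hk.rel_ap (h := f) (fun v => v 0 = v 1) h⟩
  by_contra h'
  rw [← Ev.not hk ha] at h'
  exact hk.rel_ap (h := f) (fun v => ¬ v 0 = v 1) h' h

theorem ap_pair (f g : ZFSet.{u} → ZFSet.{u}) {a : ZFSet.{u}} (ha : ∃ D, a ∈ k D) :
    ap k (fun x => ZFSet.pair (f x) (g x)) a = ZFSet.pair (ap k f a) (ap k g a) :=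
  hk.rel_ap (fun v => v 0 = ZFSet.pair (v 1) (v 2)) (Ev.of_forall hk ha fun _ => rfl)

theorem ap_const (c : ZFSet.{u}) {a : ZFSet.{u}} (ha : ∃ D, a ∈ k D) :
    ap k (fun _ => c) a = k c := by
  obtain ⟨D, hD⟩ := ha
  have h : ∀ d x, ZFSet.pair d x ∈ k (graph (fun _ => c) D) → x = k c :=
    (hk.iff ![graph (fun _ => c) D, c] (fun v => ∀ d x, ZFSet.pair d x ∈ v 0 → x = v 1)).2
    (fun d x h => (pair_mem_graph (f := fun _ => c).1 h).2.symm)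
  exact h a _ (hk.pair_ap_mem hD)

theorem ap_id {a : ZFSet.{u}} (ha : ∃ D, a ∈ k D) : ap k (fun x => x) a = a := by
  obtain ⟨D, hD⟩ := ha
  have h : ∀ d x, ZFSet.pair d x ∈ k (graph (fun x => x) D) → x = d :=
    (hk.iff ![graph (fun x => x) D] (fun v => ∀ d x, ZFSet.pair d x ∈ v 0 → x = d)).2
    (fun d x h => (pair_mem_graph (f := fun x => x).1 h).2.symm)
  exact h a _ (hk.pair_ap_mem hD)

theorem ap_ap (f g : ZFSet.{u} → ZFSet.{u}) {a : ZFSet.{u}} (ha : ∃ D, a ∈ k D) :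
    ap k g (ap k f a) = ap k (fun x => g (f x)) a := by
  obtain ⟨D, hD⟩ := ha
  have h : ∀ d x, ZFSet.pair d x ∈ k (graph f D) →
      ∀ e y, ZFSet.pair e y ∈ k (graph g (setImage f D)) → e = x →
      ∀ e' z, ZFSet.pair e' z ∈ k (graph (fun x => g (f x)) D) → e' = d → y = z :=
    (hk.iff ![graph f D, graph g (setImage f D), graph (fun x => g (f x)) D]
    (fun v => ∀ d x, ZFSet.pair d x ∈ v 0 → ∀ e y, ZFSet.pair e y ∈ v 1 → e = x →
    ∀ e' z, ZFSet.pair e' z ∈ v 2 → e' = d → y = z)).2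
    (by
      rintro d x h e y h' rfl e' z h'' rfl
      exact (pair_mem_graph (f := g).1 h').2.symm.trans ((congrArg g
        (pair_mem_graph (f := f).1 h).2.symm).trans (pair_mem_graph (f := fun x => g (f x)).1 h'').2))
  exact h a _ (hk.pair_ap_mem hD) _ _ (hk.pair_ap_mem (hk.ap_mem hD)) rfl _ _ (hk.pair_ap_mem hD) rfl

omit hk in
open Classical in
/-- The first component of a pair. -/
noncomputable def fst (x : ZFSet.{u}) : ZFSet.{u} :=
  if h : ∃ a b, x = ZFSet.pair a b then h.choose else ∅

omit hk in
open Classical in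
/-- The second component of a pair. -/
noncomputable def snd (x : ZFSet.{u}) : ZFSet.{u} :=
  if h : ∃ b a, x = ZFSet.pair a b then h.choose else ∅

omit hk in
@[simp] theorem fst_pair (a b : ZFSet.{u}) : fst (ZFSet.pair a b) = a := by
  have h : ∃ a' b', ZFSet.pair a b = ZFSet.pair a' b' := ⟨a, b, rfl⟩
  obtain ⟨b', hb⟩ := h.choose_spec
  rw [fst, dif_pos h]
  exact (ZFSet.pair_inj.1 hb).1.symm

omit hk in
@[simp] theorem snd_pair (a b : ZFSet.{u}) : snd (ZFSet.pair a b) = b := by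
  have h : ∃ b' a', ZFSet.pair a b = ZFSet.pair a' b' := ⟨b, a, rfl⟩
  obtain ⟨a', hb⟩ := h.choose_spec
  rw [snd, dif_pos h]
  exact (ZFSet.pair_inj.1 hb).2.symm

theorem pair_exists_mem {a b : ZFSet.{u}} (ha : ∃ D, a ∈ k D) (hb : ∃ D, b ∈ k D) :
    ∃ D, ZFSet.pair a b ∈ k D := by
  obtain ⟨D, hD⟩ := ha
  obtain ⟨E, hE⟩ := hb
  exact ⟨D.prod E, hk.pair_mem_prod_iff.2 ⟨hD, hE⟩⟩

theorem ap_fst_snd {a b : ZFSet.{u}} (ha : ∃ D, a ∈ k D) (hb : ∃ D, b ∈ k D) :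
    ap k fst (ZFSet.pair a b) = a ∧ ap k snd (ZFSet.pair a b) = b := by
  have h := hk.pair_exists_mem ha hb
  obtain ⟨D, hD⟩ := ha
  obtain ⟨E, hE⟩ := hb
  rw [← ZFSet.pair_inj, ← hk.ap_pair _ _ h]
  conv_rhs => rw [← hk.ap_id h]
  rw [hk.ap_eq_ap_iff h]
  refine Ev.mono hk (P := fun x => x ∈ D.prod E) ⟨D.prod E, ?_⟩ ?_
  · convert hk.pair_mem_prod_iff.2 ⟨hD, hE⟩ using 2
    ext; simp [ZFSet.mem_sep]
  · intro x hx
    obtain ⟨y, -, z, -, rfl⟩ := ZFSet.mem_prod.1 hx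
    simp

theorem ap_fst {a b : ZFSet.{u}} (ha : ∃ D, a ∈ k D) (hb : ∃ D, b ∈ k D) :
    ap k fst (ZFSet.pair a b) = a := (hk.ap_fst_snd ha hb).1

theorem ap_snd {a b : ZFSet.{u}} (ha : ∃ D, a ∈ k D) (hb : ∃ D, b ∈ k D) :
    ap k snd (ZFSet.pair a b) = b := (hk.ap_fst_snd ha hb).2

end PreservesAbsolute

end WoodinSC

/-! ### Mostowski collapse, hulls and Łoś's theorem -/

namespace WoodinSC

open scoped ZFSet
open FirstOrder Language

/-- The Mostowski collapse of a class of sets. -/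
noncomputable def collapse (H : Set ZFSet.{u}) (x : ZFSet.{u}) : ZFSet.{u} :=
  ZFSet.range fun y : {y : x // (y : ZFSet.{u}) ∈ H} => collapse H y.1
termination_by x
decreasing_by exact y.1.2

theorem mem_collapse {H : Set ZFSet.{u}} {x y : ZFSet.{u}} :
    y ∈ collapse H x ↔ ∃ z ∈ x, z ∈ H ∧ collapse H z = y := by
  rw [collapse]
  simp only [ZFSet.mem_range, Subtype.exists]
  constructor
  · rintro ⟨z, hz, hzH, h⟩; exact ⟨z, hz, hzH, h⟩
  · rintro ⟨z, hz, hzH, h⟩; exact ⟨z, hz, hzH, h⟩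

/-- Distinct elements of `H` have distinct elements in `H`. -/
def IsExtensional (H : Set ZFSet.{u}) : Prop :=
  ∀ x ∈ H, ∀ y ∈ H, (∀ z ∈ H, z ∈ x ↔ z ∈ y) → x = y

namespace IsExtensional

variable {H : Set ZFSet.{u}} (hH : IsExtensional H)
include hH

theorem collapse_injOn : Set.InjOn (collapse H) H := by
  intro x hx y hy h
  induction x using ZFSet.inductionOn generalizing y with
  | h x ih =>
    refine hH x hx y hy fun z hz => ⟨fun hzx => ?_, fun hzy => ?_⟩
    · have : collapse H z ∈ collapse H y := h ▸ mem_collapse.2 ⟨z, hzx, hz, rfl⟩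
      obtain ⟨w, hw, hwH, e⟩ := mem_collapse.1 this
      rwa [ih z hzx hz hwH e.symm]
    · have : collapse H z ∈ collapse H x := h ▸ mem_collapse.2 ⟨z, hzy, hz, rfl⟩
      obtain ⟨w, hw, hwH, e⟩ := mem_collapse.1 this
      rwa [← ih w hw hwH hz e]

theorem collapse_mem_iff {x y : ZFSet.{u}} (hx : x ∈ H) :
    collapse H x ∈ collapse H y ↔ x ∈ y := by
  rw [mem_collapse]
  refine ⟨?_, fun h => ⟨x, h, hx, rfl⟩⟩
  rintro ⟨z, hz, hzH, e⟩
  rwa [← hH.collapse_injOn hzH hx e]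

theorem isTransitiveInclusion : IsTransitiveInclusion fun x : H => collapse H x :=
  ⟨fun x y h => Subtype.ext (hH.collapse_injOn x.2 y.2 h),
    fun x => (hH.collapse_mem_iff (x 0).2).symm, fun x y hy => by
      obtain ⟨z, -, hz, rfl⟩ := mem_collapse.1 hy
      exact ⟨⟨z, hz⟩, rfl⟩⟩

/-- The collapse as an isomorphism of structures. -/
noncomputable def collapseEquiv : H ≃[setLang] (collapse H '' H : Set ZFSet.{u}) where
  toEquiv := Equiv.Set.imageOfInjOn _ _ hH.collapse_injOn
  map_fun' := fun f => Empty.elim f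
  map_rel' := fun r x => by
    cases r
    exact hH.collapse_mem_iff (x 0).2

end IsExtensional

theorem collapse_eq_self {H : Set ZFSet.{u}} {x : ZFSet.{u}} (hx : x.IsTransitive)
    (hxH : ∀ y ∈ x, y ∈ H) : collapse H x = x := by
  have key : ∀ y ∈ x, collapse H y = y := by
    intro y
    induction y using ZFSet.inductionOn with
    | h y ih =>
      intro hy
      ext z
      rw [mem_collapse]
      constructor
      · rintro ⟨w, hw, -, rfl⟩
        rwa [ih w hw (hx.mem_trans hw hy)]
      · intro hz
        exact ⟨z, hz, hxH z (hx.mem_trans hz hy), ih z hz (hx.mem_trans hz hy)⟩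
  ext z
  rw [mem_collapse]
  constructor
  · rintro ⟨w, hw, -, rfl⟩
    rwa [key w hw]
  · intro hz
    exact ⟨z, hz, hxH z hz, key z hz⟩

open PreservesAbsolute

/-- The class `Z` can serve as the class of generators of a hull of the extension `k`. -/
structure IsGenerating (k : ZFSet.{u} → ZFSet.{u}) (Z : Set ZFSet.{u}) : Prop where
  preserves : PreservesAbsolute k
  nonempty : Z.Nonempty
  exists_mem : ∀ z ∈ Z, ∃ D, z ∈ k D
  directed : ∀ z ∈ Z, ∀ w ∈ Z, ∃ y ∈ Z, (∃ f, ap k f y = z) ∧ ∃ g, ap k g y = w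

/-- The class of all values of extended functions at elements of `Z`. -/
def hull (k : ZFSet.{u} → ZFSet.{u}) (Z : Set ZFSet.{u}) : Set ZFSet.{u} :=
  {x | ∃ z ∈ Z, ∃ f, ap k f z = x}

namespace IsGenerating

variable {k : ZFSet.{u} → ZFSet.{u}} {Z : Set ZFSet.{u}} (hZ : IsGenerating k Z)
include hZ

theorem exists_common {x y : ZFSet.{u}} (hx : x ∈ hull k Z) (hy : y ∈ hull k Z) :
    ∃ z ∈ Z, (∃ f, ap k f z = x) ∧ ∃ g, ap k g z = y := by
  obtain ⟨z, hz, f, rfl⟩ := hx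
  obtain ⟨w, hw, g, rfl⟩ := hy
  obtain ⟨y, hy, ⟨p, rfl⟩, ⟨q, rfl⟩⟩ := hZ.directed z hz w hw
  have hy' := hZ.exists_mem y hy
  exact ⟨y, hy, ⟨_, (hZ.preserves.ap_ap p f hy').symm⟩, ⟨_, (hZ.preserves.ap_ap q g hy').symm⟩⟩

theorem map_mem_hull (x : ZFSet.{u}) : k x ∈ hull k Z := by
  obtain ⟨z, hz⟩ := hZ.nonempty
  exact ⟨z, hz, _, hZ.preserves.ap_const x (hZ.exists_mem z hz)⟩

/-- If two values differ, choice gives a function w picking pointwise an element of the symmetric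
difference, and the value of w lies in the hull and separates them. -/
theorem isExtensional : IsExtensional (hull k Z) := by
  intro x hx y hy h
  obtain ⟨z, hz, ⟨f, rfl⟩, ⟨g, rfl⟩⟩ := hZ.exists_common hx hy
  have hz' := hZ.exists_mem z hz
  have hk := hZ.preserves
  by_contra hne
  rw [hk.ap_eq_ap_iff hz', ← Ev.not hk hz'] at hne
  have hw : ∀ d, ∃ w, f d ≠ g d → ¬ (w ∈ f d ↔ w ∈ g d) := by
    intro d
    by_cases hd : f d = g d
    · exact ⟨∅, fun h => (h hd).elim⟩
    · by_contra hc
      push Not at hc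
      exact hd (ZFSet.ext fun w => (hc w).2)
  choose w hw using hw
  have h₁ := Ev.mono hk hne hw
  have h₂ := h (ap k w z) ⟨z, hz, w, rfl⟩
  rw [hk.ap_mem_ap_iff hz', hk.ap_mem_ap_iff hz'] at h₂
  rw [Ev.not hk hz'] at h₁
  by_cases hf : Ev k z fun x => w x ∈ f x
  · exact h₁ (Ev.mono hk (Ev.and hk hf (h₂.1 hf)) fun x hx => iff_of_true hx.1 hx.2)
  · have hg := mt h₂.2 hf
    rw [← Ev.not hk hz'] at hf hg
    exact h₁ (Ev.mono hk (Ev.and hk hf hg) fun x hx => iff_of_false hx.1 hx.2)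

/-- Łoś's theorem. Pointwise counterexamples chosen in V serve as Skolem functions for the
quantifier step. -/
theorem realize_hull_iff {α : Type} {m : ℕ} (φ : setLang.BoundedFormula α m) {z : ZFSet.{u}}
    (hz : z ∈ Z) (f : α → ZFSet.{u} → ZFSet.{u}) (g : Fin m → ZFSet.{u} → ZFSet.{u})
    (v : α → hull k Z) (w : Fin m → hull k Z) (hv : ∀ i, (v i : ZFSet.{u}) = ap k (f i) z)
    (hw : ∀ i, (w i : ZFSet.{u}) = ap k (g i) z) :
    φ.Realize v w ↔ Ev k z fun d => φ.Realize (fun i => f i d) fun i => g i d := by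
  have hk := hZ.preserves
  have term : ∀ {m : ℕ} (t : setLang.Term (α ⊕ Fin m)), ∃ i, t = Term.var i := by
    intro m t
    cases t with
    | var i => exact ⟨i, rfl⟩
    | func f _ => exact Empty.elim f
  induction φ generalizing z f with
  | falsum => simpa [BoundedFormula.Realize] using
      (Ev.const_iff hk (hZ.exists_mem z hz) False).not.2 id
  | equal t₁ t₂ =>
    obtain ⟨i₁, rfl⟩ := term t₁
    obtain ⟨i₂, rfl⟩ := term t₂
    have hs : ∀ i, ((Sum.elim v w i : hull k Z) : ZFSet.{u}) = ap k (Sum.elim f g i) z := by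
      rintro (i | i)
      exacts [hv i, hw i]
    simp only [BoundedFormula.Realize, Term.realize_var]
    rw [← Subtype.coe_inj, hs, hs, hk.ap_eq_ap_iff (hZ.exists_mem z hz)]
    refine iff_of_eq (congrArg (Ev k z) (funext fun d => ?_))
    cases i₁ <;> cases i₂ <;> rfl
  | rel r ts =>
    cases r with
    | mem =>
    obtain ⟨i₁, h₁⟩ := term (ts 0)
    obtain ⟨i₂, h₂⟩ := term (ts 1)
    have hs : ∀ i, ((Sum.elim v w i : hull k Z) : ZFSet.{u}) = ap k (Sum.elim f g i) z := by
      rintro (i | i)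
      exacts [hv i, hw i]
    have e₁ : BoundedFormula.Realize (.rel SetRel.mem ts) v w ↔
        ((Sum.elim v w i₁ : hull k Z) : ZFSet.{u}) ∈ ((Sum.elim v w i₂ : hull k Z) : ZFSet.{u}) := by
      change ((ts 0).realize (Sum.elim v w)).1 ∈ ((ts 1).realize (Sum.elim v w)).1 ↔ _
      rw [h₁, h₂]
      rfl
    rw [e₁, hs, hs, hk.ap_mem_ap_iff (hZ.exists_mem z hz)]
    refine iff_of_eq (congrArg (Ev k z) (funext fun d => propext ?_))
    change _ ↔ (ts 0).realize (Sum.elim (fun i => f i d) (fun i => g i d)) ∈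
        (ts 1).realize (Sum.elim (fun i => f i d) (fun i => g i d))
    rw [h₁, h₂]
    cases i₁ <;> cases i₂ <;> rfl
  | imp φ ψ ihφ ihψ =>
    have hz' := hZ.exists_mem z hz
    simp only [BoundedFormula.realize_imp]
    refine (imp_congr (ihφ hz f g w hv hw) (ihψ hz f g w hv hw)).trans ?_
    constructor
    · intro h
      by_cases hφ : Ev k z fun d => φ.Realize (fun i => f i d) fun i => g i d
      · exact Ev.mono hk (h hφ) fun x hx _ => hx
      · exact Ev.mono hk ((Ev.not hk hz').2 hφ) fun x hx hx' => (hx hx').elim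
    · intro h hφ
      exact Ev.mono hk (Ev.and hk h hφ) fun x hx => hx.1 hx.2
  | all φ ih =>
    simp only [BoundedFormula.realize_all]
    have hz' := hZ.exists_mem z hz
    have snoc_apply : ∀ {m : ℕ} (g : Fin m → ZFSet.{u} → ZFSet.{u}) (h : ZFSet.{u} → ZFSet.{u}) d,
        (fun i => (Fin.snoc g h : Fin (m + 1) → ZFSet.{u} → ZFSet.{u}) i d) =
          (Fin.snoc (fun i => g i d) (h d) : Fin (m + 1) → ZFSet.{u}) := by
      intro m g h d
      funext i
      refine Fin.lastCases ?_ (fun i => ?_) i <;> simp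
    constructor
    · intro H
      by_contra hne
      rw [← Ev.not hk hz'] at hne
      have hx : ∀ d, ∃ x, ¬ (∀ a, φ.Realize (fun i => f i d) (Fin.snoc (fun i => g i d) a)) →
          ¬ φ.Realize (fun i => f i d) (Fin.snoc (fun i => g i d) x) := by
        intro d
        by_cases hd : ∀ a, φ.Realize (fun i => f i d) (Fin.snoc (fun i => g i d) a)
        · exact ⟨∅, fun h => (h hd).elim⟩
        · push Not at hd
          exact hd.imp fun a ha _ => ha
      choose h hh using hx
      have h₁ := (ih hz f (Fin.snoc g h) (Fin.snoc w ⟨ap k h z, z, hz, h, rfl⟩) hv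
        (fun i => by refine Fin.lastCases ?_ (fun i => ?_) i <;> simp [hw])).1 (H _)
      simp only [snoc_apply] at h₁
      exact (Ev.not hk hz').1 (Ev.mono hk hne hh) h₁
    · rintro H ⟨x, hx⟩
      -- Directedness: the old generator and the new element become functions of a single generator
      -- `y`, so the induction hypothesis applies at `y`.
      obtain ⟨y, hy, ⟨p, rfl⟩, ⟨q, rfl⟩⟩ := hZ.exists_common ⟨z, hz, fun x => x, hk.ap_id hz'⟩ hx
      have hy' := hZ.exists_mem y hy
      rw [hk.ev_ap_iff hy'] at H
      refine (ih hy (fun i d => f i (p d)) (Fin.snoc (fun i d => g i (p d)) q) _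
        (fun i => by rw [hv, hk.ap_ap _ _ hy']) (fun i => ?_)).2 ?_
      · refine Fin.lastCases ?_ (fun i => ?_) i
        · simp
        · simp [hw, hk.ap_ap _ _ hy']
      · simp only [snoc_apply]
        exact Ev.mono hk H fun d hd => hd _

/-- The collapsed hull is a transitive class, so an absolute relation between its elements is
evaluated in V while Łoś's theorem is applied to its formula in the hull. -/
theorem absolute_collapse_iff {n : ℕ} (R : (Fin n → ZFSet.{u}) → Prop) [hR : IsAbsolute R]
    {z : ZFSet.{u}} (hz : z ∈ Z) (f : Fin n → ZFSet.{u} → ZFSet.{u}) :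
    R (fun i => collapse (hull k Z) (ap k (f i) z)) ↔ Ev k z fun d => R fun i => f i d := by
  obtain ⟨φ, hφ⟩ := hR
  rw [← hφ _ hZ.isExtensional.isTransitiveInclusion fun i => ⟨ap k (f i) z, z, hz, f i, rfl⟩]
  refine (hZ.realize_hull_iff φ hz f Fin.elim0 _ _ (fun _ => rfl) fun i => i.elim0).trans ?_
  refine iff_of_eq (congrArg (Ev k z) (funext fun d => propext ?_))
  refine Iff.trans ?_ (hφ _ isTransitiveInclusion_id fun i => f i d)
  exact iff_of_eq (congrArg _ (Subsingleton.elim _ _))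

/-- The elementary embedding of the universe into the collapse of the hull. -/
noncomputable def embedding : UniverseEmbedding.{u} where
  M := collapse (hull k Z) '' hull k Z
  transitive := by
    rintro _ ⟨x, hx, rfl⟩ y hy
    obtain ⟨z, -, hz, rfl⟩ := mem_collapse.1 hy
    exact ⟨z, hz, rfl⟩
  emb :=
    { toFun := fun x => hZ.isExtensional.collapseEquiv ⟨k x, hZ.map_mem_hull x⟩
      map_formula' := fun n φ v => by
        change φ.Realize (hZ.isExtensional.collapseEquiv ∘ fun i =>
          (⟨k (v i), hZ.map_mem_hull _⟩ : hull k Z)) ↔ _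
        rw [StrongHomClass.realize_formula]
        obtain ⟨z, hz⟩ := hZ.nonempty
        refine (hZ.realize_hull_iff φ hz (fun i _ => v i) Fin.elim0 _ _
          (fun i => (hZ.preserves.ap_const _ (hZ.exists_mem z hz)).symm) fun i => i.elim0).trans ?_
        refine Iff.trans ?_ (Ev.const_iff hZ.preserves (hZ.exists_mem z hz) (φ.Realize v))
        refine iff_of_eq (congrArg (Ev k z) (funext fun d => ?_))
        exact congrArg (BoundedFormula.Realize φ v) (Subsingleton.elim _ _) }

theorem embedding_app (x : ZFSet.{u}) : hZ.embedding.app x = collapse (hull k Z) (k x) := rfl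

end IsGenerating

end WoodinSC

/-! ### Size properties of critical points -/

namespace WoodinSC

open scoped ZFSet

theorem exists_surjOn_of_card_le {x y : ZFSet.{u}} (h : y.card ≤ x.card) (hy : ∃ b, b ∈ y) :
    ∃ g : ZFSet.{u} → ZFSet.{u}, (∀ a ∈ x, g a ∈ y) ∧ ∀ b ∈ y, ∃ a ∈ x, g a = b := by
  classical
  obtain ⟨b₀, hb₀⟩ := hy
  obtain ⟨i⟩ := Cardinal.le_def _ _ |>.1 h
  let e : y ↪ x := ((equivShrink y).toEmbedding.trans i).trans (equivShrink x).symm.toEmbedding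
  refine ⟨fun a => if ha : ∃ b : y, (e b : ZFSet.{u}) = a then ha.choose else b₀, ?_, ?_⟩
  · intro a _
    dsimp only
    split_ifs with h
    · exact h.choose.2
    · exact hb₀
  · intro b hb
    refine ⟨e ⟨b, hb⟩, (e ⟨b, hb⟩).2, ?_⟩
    have h : ∃ b' : y, (e b' : ZFSet.{u}) = e ⟨b, hb⟩ := ⟨⟨b, hb⟩, rfl⟩
    dsimp only
    rw [dif_pos h]
    exact congrArg Subtype.val (e.injective (Subtype.ext h.choose_spec))

theorem exists_injOn_of_card_le {x y : ZFSet.{u}} (h : x.card ≤ y.card) :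
    ∃ g : ZFSet.{u} → ZFSet.{u}, (∀ a ∈ x, g a ∈ y) ∧
      ∀ a ∈ x, ∀ b ∈ x, g a = g b → a = b := by
  classical
  obtain ⟨i⟩ := Cardinal.le_def _ _ |>.1 h
  let e : x ↪ y := ((equivShrink x).toEmbedding.trans i).trans (equivShrink y).symm.toEmbedding
  refine ⟨fun a => if ha : a ∈ x then e ⟨a, ha⟩ else ∅, ?_, ?_⟩
  · intro a ha
    simp only [ha, dif_pos]
    exact (e ⟨a, ha⟩).2
  · intro a ha b hb hab
    simp only [ha, hb, dif_pos] at hab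
    exact congrArg Subtype.val (e.injective (Subtype.ext hab))

theorem PreservesAbsolute.map_insert {k : ZFSet.{u} → ZFSet.{u}} (hk : PreservesAbsolute k)
    (x y : ZFSet.{u}) : k (insert x y) = insert (k x) (k y) := by
  have h : (∀ z ∈ k (insert x y), z = k x ∨ z ∈ k y) ∧ k x ∈ k (insert x y) ∧
      ∀ z ∈ k y, z ∈ k (insert x y) :=
    (hk.iff ![insert x y, x, y] (fun v => (∀ z ∈ v 0, z = v 1 ∨ z ∈ v 2) ∧ v 1 ∈ v 0 ∧
      ∀ z ∈ v 2, z ∈ v 0)).2 ⟨fun z => ZFSet.mem_insert_iff.1, ZFSet.mem_insert _ _,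
        fun z => ZFSet.mem_insert_of_mem _⟩
  ext z
  rw [ZFSet.mem_insert_iff]
  exact ⟨h.1 z, by rintro (rfl | hz); exacts [h.2.1, h.2.2 z hz]⟩

namespace UniverseEmbedding

variable {j : UniverseEmbedding.{u}} {κ : Cardinal.{u}}

/-- A domain fixed pointwise and as a set gains no points, so j(f ↾ D) is just d ↦ j(f d). -/
theorem of_pair_mem_app_graph {D x y : ZFSet.{u}} {f : ZFSet.{u} → ZFSet.{u}} (hD : j.app D = D)
    (hD' : ∀ x ∈ D, j.app x = x) (h : ZFSet.pair x y ∈ j.app (graph f D)) :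
    x ∈ D ∧ y = j.app (f x) := by
  have hj := j.preservesAbsolute
  have h₁ : ∀ x y, ZFSet.pair x y ∈ j.app (graph f D) → x ∈ j.app D :=
    (hj.iff ![graph f D, D] (fun v => ∀ x y, ZFSet.pair x y ∈ v 0 → x ∈ v 1)).2
      fun x y h => (pair_mem_graph.1 h).1
  have h₂ : ∀ x y, ZFSet.pair x y ∈ j.app (graph f D) → ∀ x' z,
      ZFSet.pair x' z ∈ j.app (graph f D) → x' = x → y = z :=
    (hj.iff ![graph f D] (fun v => ∀ x y, ZFSet.pair x y ∈ v 0 → ∀ x' z,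
      ZFSet.pair x' z ∈ v 0 → x' = x → y = z)).2
      fun x y h x' z h' e => by
        have := (pair_mem_graph (f := f).1 h).2
        have := (pair_mem_graph (f := f).1 h').2
        simp_all
  have hx : x ∈ D := hD ▸ h₁ x y h
  refine ⟨hx, h₂ x y h x _ ?_ rfl⟩
  conv => enter [2, 1]; rw [← hD' x hx]
  rw [← hj.map_pair, hj.mem_iff]
  exact pair_mem_graph.2 ⟨hx, rfl⟩

variable (hc : j.HasCrit κ.ord)
include hc

theorem HasCrit.app_eq {x : ZFSet.{u}} (hx : x ∈ κ.ord.toZFSet) : j.app x = x := by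
  obtain ⟨a, ha, rfl⟩ := Ordinal.mem_toZFSet_iff.1 hx
  exact hc.1 a ha

/-- Each element of V_a is a subset of some value of b ↦ V_b on a. This is a bounded statement about
that function, and j adds no points to its domain, so by induction j(V_a) has no new elements. -/
theorem HasCrit.vonNeumann {a : Ordinal.{u}} (ha : a < κ.ord) :
    j.app (V_ a) = V_ a ∧ ∀ x ∈ V_ a, j.app x = x := by
  have hj := j.preservesAbsolute
  induction a using WellFoundedLT.induction with
  | ind a ih =>
  have key : ∀ y, (∃ b < a, y ⊆ V_ b) → j.app y = y := by
    rintro y ⟨b, hb, hy⟩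
    obtain ⟨h₁, h₂⟩ := ih b hb (hb.trans ha)
    ext z
    constructor
    · intro hz
      have hz' : z ∈ V_ b := h₁ ▸ hj.subset_iff.2 hy hz
      rw [← h₂ z hz'] at hz
      exact hj.mem_iff.1 hz
    · intro hz
      rw [← h₂ z (hy hz)]
      exact hj.mem_iff.2 hz
  have hel : ∀ x ∈ V_ a, j.app x = x := fun x hx => key x (ZFSet.mem_vonNeumann'.1 hx)
  refine ⟨?_, hel⟩
  ext y
  constructor
  · intro hy
    have h₀ : ∀ y ∈ V_ a, ∃ b w,
        ZFSet.pair b w ∈ graph (fun x => V_ x.rank) a.toZFSet ∧ y ⊆ w := by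
      intro y hy
      obtain ⟨b, hb, hy⟩ := ZFSet.mem_vonNeumann'.1 hy
      exact ⟨b.toZFSet, V_ b, pair_mem_graph.2
        ⟨Ordinal.toZFSet_mem_toZFSet_iff.2 hb, by simp⟩, hy⟩
    have h : ∀ y ∈ j.app (V_ a), ∃ b w,
        ZFSet.pair b w ∈ j.app (graph (fun x => V_ x.rank) a.toZFSet) ∧ y ⊆ w :=
      (hj.iff ![V_ a, graph (fun x => V_ x.rank) a.toZFSet] (fun v => ∀ y ∈ v 0, ∃ b w,
        ZFSet.pair b w ∈ v 1 ∧ y ⊆ w)).2 h₀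
    obtain ⟨b, w, hbw, hyw⟩ := h y hy
    obtain ⟨hb, rfl⟩ := of_pair_mem_app_graph (hc.1 a ha)
      (fun x hx => hc.app_eq (Ordinal.toZFSet_monotone ha.le hx)) hbw
    obtain ⟨c, hca, rfl⟩ := Ordinal.mem_toZFSet_iff.1 hb
    rw [ZFSet.mem_vonNeumann']
    refine ⟨c, hca, ?_⟩
    simpa [(ih c hca (hca.trans ha)).1] using hyw
  · intro hy
    rw [← hel y hy]
    exact hj.mem_iff.2 hy

theorem HasCrit.add_one_lt {a : Ordinal.{u}} (ha : a < κ.ord) : a + 1 < κ.ord := by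
  refine lt_of_le_of_ne (Order.add_one_le_of_lt ha) fun h => hc.2 ?_
  rw [← h, Ordinal.toZFSet_add_one, j.preservesAbsolute.map_insert, hc.1 a ha]

variable (hκ : κ.ord.toZFSet ∈ j.app κ.ord.toZFSet)
include hκ

/-- Otherwise some g maps x onto κ. Then j(g) maps onto j(κ), which contains κ, yet the values of
j(g) are j(g d) = g d < κ. -/
theorem HasCrit.card_lt {x : ZFSet.{u}} (hx : j.app x = x) (hx' : ∀ y ∈ x, j.app y = y) :
    x.card < κ := by
  have hj := j.preservesAbsolute
  by_contra! hle
  obtain ⟨g, hg, hg'⟩ := exists_surjOn_of_card_le (x := x) (y := κ.ord.toZFSet) (by simpa) (by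
    by_contra! h
    rw [← ZFSet.eq_empty] at h
    rw [h, hj.map_empty] at hκ
    exact ZFSet.notMem_empty _ hκ)
  have h : ∀ b ∈ j.app κ.ord.toZFSet, ∃ a c, ZFSet.pair a c ∈ j.app (graph g x) ∧ c = b :=
    (hj.iff ![κ.ord.toZFSet, graph g x] (fun v => ∀ b ∈ v 0, ∃ a c, ZFSet.pair a c ∈ v 1 ∧
      c = b)).2 (fun b hb => (hg' b hb).elim fun a ha => ⟨a, b, pair_mem_graph.2 ha, rfl⟩)
  obtain ⟨a, c, hac, rfl⟩ := h _ hκ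
  obtain ⟨ha, e⟩ := of_pair_mem_app_graph hx hx' hac
  rw [hc.app_eq (hg a ha)] at e
  exact ZFSet.mem_irrefl _ (e ▸ hg a ha)

theorem HasCrit.card_vonNeumann_lt {a : Ordinal.{u}} (ha : a < κ.ord) : (V_ a).card < κ :=
  hc.card_lt hκ (hc.vonNeumann ha).1 (hc.vonNeumann ha).2

/-- Every element of ω is empty or a successor. This passes to j(ω), so ∈-induction finds no new
elements there, whereas κ = ω would be one. -/
theorem HasCrit.omega0_lt : Ordinal.omega0 < κ.ord := by
  have hj := j.preservesAbsolute
  have hle : Ordinal.omega0 ≤ κ.ord := by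
    rw [Ordinal.omega0_le]
    intro n
    induction n with
    | zero => simp
    | succ n ih =>
      rcases ih.lt_or_eq with h | h
      · exact_mod_cast (hc.add_one_lt h).le
      · exfalso
        cases n with
        | zero =>
          rw [← h, Nat.cast_zero, Ordinal.toZFSet_zero, hj.map_empty] at hκ
          exact ZFSet.notMem_empty _ hκ
        | succ n =>
          have := hc.add_one_lt (a := n) (by rw [← h]; exact_mod_cast Nat.lt_succ_self n)
          rw [← h] at this
          exact lt_irrefl _ (by exact_mod_cast this)
  refine lt_of_le_of_ne hle fun e => ?_
  rw [← e] at hκ hc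
  have h : ∀ y ∈ j.app Ordinal.omega0.toZFSet, (∀ z ∈ y, ¬ z = z) ∨
      ∃ z ∈ y, (∀ w ∈ z, w ∈ y) ∧ ∀ w ∈ y, w = z ∨ w ∈ z :=
    (hj.iff ![Ordinal.omega0.toZFSet] (fun v => ∀ y ∈ v 0, (∀ z ∈ y, ¬ z = z) ∨
      ∃ z ∈ y, (∀ w ∈ z, w ∈ y) ∧ ∀ w ∈ y, w = z ∨ w ∈ z)).2 (by
        intro y hy
        obtain ⟨a, ha, rfl⟩ := Ordinal.mem_toZFSet_iff.1 hy
        obtain ⟨n, rfl⟩ := Ordinal.lt_omega0.1 ha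
        cases n with
        | zero => left; simp
        | succ n =>
          right
          refine ⟨(n : Ordinal.{u}).toZFSet, ?_⟩
          rw [Nat.cast_succ, Ordinal.toZFSet_add_one]
          exact ⟨by simp, fun w hw => ZFSet.mem_insert_of_mem _ hw,
            fun w => ZFSet.mem_insert_iff.1⟩)
  have htr := hj.isTransitive (ZFSet.isOrdinal_toZFSet Ordinal.omega0).isTransitive
  have key : ∀ y ∈ j.app Ordinal.omega0.toZFSet, y ∈ Ordinal.omega0.toZFSet := by
    intro y
    induction y using ZFSet.inductionOn with
    | h y ih =>
      intro hy
      rcases h y hy with h | ⟨z, hz, h₁, h₂⟩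
      · rw [(ZFSet.eq_empty y).2 fun z hz => h z hz rfl, ← Ordinal.toZFSet_zero,
          Ordinal.toZFSet_mem_toZFSet_iff]
        exact Ordinal.omega0_pos
      · obtain ⟨a, ha, rfl⟩ := Ordinal.mem_toZFSet_iff.1 (ih z hz (htr.mem_trans hz hy))
        have : y = (a + 1).toZFSet := by
          rw [Ordinal.toZFSet_add_one]
          ext w
          rw [ZFSet.mem_insert_iff]
          exact ⟨h₂ w, by rintro (rfl | hw); exacts [hz, h₁ w hw]⟩
        rw [this, Ordinal.toZFSet_mem_toZFSet_iff]
        exact Ordinal.isSuccLimit_omega0.succ_lt ha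
  exact ZFSet.mem_irrefl _ (key _ hκ)

theorem HasCrit.aleph0_lt : Cardinal.aleph0 < κ := by
  have := hc.omega0_lt hκ
  rwa [← Cardinal.ord_aleph0, Cardinal.ord_lt_ord] at this

theorem HasCrit.add_omega0_lt {a : Ordinal.{u}} (ha : a < κ.ord) :
    a + Ordinal.omega0 < κ.ord :=
  Ordinal.isPrincipal_add_ord (hc.aleph0_lt hκ).le ha (hc.omega0_lt hκ)

end UniverseEmbedding

end WoodinSC

/-! ### Cardinality, generators closed under pairing, weak covers -/

namespace WoodinSC

open scoped ZFSet
open PreservesAbsolute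

theorem card_le_of_injOn {s t : ZFSet.{u}} (g : ZFSet.{u} → ZFSet.{u}) (hg : ∀ a ∈ s, g a ∈ t)
    (hg' : ∀ a ∈ s, ∀ b ∈ s, g a = g b → a = b) : s.card ≤ t.card := by
  rw [← Cardinal.lift_le.{u + 1}, ← ZFSet.cardinalMk_coe_sort, ← ZFSet.cardinalMk_coe_sort]
  exact Cardinal.mk_le_of_injective (f := fun a : s => (⟨g a, hg a a.2⟩ : t))
    fun a b h => Subtype.ext (hg' a a.2 b b.2 (congrArg Subtype.val h))

theorem card_le_of_isFunc {s t f : ZFSet.{u}} (hf : ZFSet.IsFunc s t f)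
    (hinj : ∀ x y z, ZFSet.pair x z ∈ f → ZFSet.pair y z ∈ f → x = y) : s.card ≤ t.card := by
  have h : ∀ x, ∃ y, x ∈ s → ZFSet.pair x y ∈ f := by
    intro x
    by_cases hx : x ∈ s
    · obtain ⟨y, hy, -⟩ := hf.2 x hx
      exact ⟨y, fun _ => hy⟩
    · exact ⟨∅, fun h => (hx h).elim⟩
  choose g hg using h
  refine card_le_of_injOn g (fun a ha => (ZFSet.pair_mem_prod.1 (hf.1 (hg a ha))).2) ?_
  intro a ha b hb h
  exact hinj a b (g a) (hg a ha) (h ▸ hg b hb)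

theorem card_setImage_le (f : ZFSet.{u} → ZFSet.{u}) (D : ZFSet.{u}) :
    (setImage f D).card ≤ D.card := by
  have h : ∀ y, ∃ x, y ∈ setImage f D → x ∈ D ∧ f x = y := by
    intro y
    by_cases hy : y ∈ setImage f D
    · obtain ⟨x, hx⟩ := mem_setImage.1 hy
      exact ⟨x, fun _ => hx⟩
    · exact ⟨∅, fun h => (hy h).elim⟩
  choose g hg using h
  refine card_le_of_injOn g (fun a ha => (hg a ha).1) fun a ha b hb h => ?_
  rw [← (hg a ha).2, ← (hg b hb).2, h]

theorem card_prod (x y : ZFSet.{u}) : (x.prod y).card = x.card * y.card := by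
  rw [← Cardinal.lift_inj.{u, u + 1}, Cardinal.lift_mul, ← ZFSet.cardinalMk_coe_sort,
    ← ZFSet.cardinalMk_coe_sort, ← ZFSet.cardinalMk_coe_sort, Cardinal.mul_def]
  refine (Cardinal.mk_congr (Equiv.ofBijective
    (fun p : x × y => (⟨ZFSet.pair p.1 p.2, ZFSet.pair_mem_prod.2 ⟨p.1.2, p.2.2⟩⟩ : x.prod y))
    ⟨?_, ?_⟩)).symm
  · rintro ⟨⟨a, ha⟩, ⟨b, hb⟩⟩ ⟨⟨c, hc⟩, ⟨d, hd⟩⟩ h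
    obtain ⟨rfl, rfl⟩ := ZFSet.pair_inj.1 (congrArg Subtype.val h)
    rfl
  · rintro ⟨p, hp⟩
    obtain ⟨a, ha, b, hb, rfl⟩ := ZFSet.mem_prod.1 hp
    exact ⟨(⟨a, ha⟩, ⟨b, hb⟩), rfl⟩

/-- A canonical transitive set containing `x` and closed under pairs. -/
noncomputable def pairClosure (x : ZFSet.{u}) : ZFSet.{u} := V_ (x.rank + Ordinal.omega0)

theorem mem_pairClosure (x : ZFSet.{u}) : x ∈ pairClosure x := by
  rw [pairClosure, ZFSet.mem_vonNeumann]
  exact lt_add_of_pos_right _ Ordinal.omega0_pos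

theorem isTransitive_pairClosure (x : ZFSet.{u}) : (pairClosure x).IsTransitive :=
  ZFSet.isTransitive_vonNeumann _

theorem rank_pair_lt {a : Ordinal.{u}} (ha : Order.IsSuccLimit a) {x y : ZFSet.{u}}
    (hx : x.rank < a) (hy : y.rank < a) : (ZFSet.pair x y).rank < a := by
  simp only [ZFSet.pair, ZFSet.rank_pair, ZFSet.rank_singleton, max_lt_iff]
  exact ⟨ha.succ_lt (ha.succ_lt hx), ha.succ_lt (max_lt (ha.succ_lt hx) (ha.succ_lt hy))⟩

theorem pair_mem_pairClosure {x y z : ZFSet.{u}} (hy : y ∈ pairClosure x)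
    (hz : z ∈ pairClosure x) : ZFSet.pair y z ∈ pairClosure x := by
  rw [pairClosure, ZFSet.mem_vonNeumann] at *
  exact rank_pair_lt (Ordinal.isSuccLimit_add _ Ordinal.isSuccLimit_omega0) hy hz

/-- Closure of Q under pairs gives directedness: ((a, b), c) determines both (a, c) and (b, c).
Every generator carries c, so all functions may use it as a parameter. -/
theorem isGenerating_pair {k : ZFSet.{u} → ZFSet.{u}} (hk : PreservesAbsolute k)
    {Q c : ZFSet.{u}} (hQ : ∃ D, Q ∈ k D) (hQ' : ∃ a, a ∈ Q)
    (hpair : ∀ x ∈ Q, ∀ y ∈ Q, ZFSet.pair x y ∈ Q) (hc : ∃ D, c ∈ k D) :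
    IsGenerating k {z | ∃ a ∈ Q, z = ZFSet.pair a c} := by
  have hmem : ∀ a ∈ Q, ∃ D, a ∈ k D := by
    obtain ⟨D, hD⟩ := hQ
    intro a ha
    have h₀ : ∀ q ∈ D, ∀ a ∈ q, a ∈ (ZFSet.sUnion D : ZFSet.{u}) := fun q hq a ha =>
      ZFSet.mem_sUnion_of_mem ha hq
    have h : ∀ q ∈ k D, ∀ a ∈ q, a ∈ k (ZFSet.sUnion D) :=
      (hk.iff ![D, ZFSet.sUnion D] (fun v => ∀ q ∈ v 0, ∀ a ∈ q, a ∈ v 1)).2 h₀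
    exact ⟨_, h Q hD a ha⟩
  refine ⟨hk, ?_, ?_, ?_⟩
  · obtain ⟨a, ha⟩ := hQ'
    exact ⟨_, a, ha, rfl⟩
  · rintro _ ⟨a, ha, rfl⟩
    exact hk.pair_exists_mem (hmem a ha) hc
  · rintro _ ⟨a, ha, rfl⟩ _ ⟨b, hb, rfl⟩
    have ha' := hmem a ha
    have hb' := hmem b hb
    have hab := hk.pair_exists_mem ha' hb'
    have habc := hk.pair_exists_mem hab hc
    refine ⟨ZFSet.pair (ZFSet.pair a b) c, ⟨_, hpair a ha b hb, rfl⟩,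
      ⟨fun y => ZFSet.pair (fst (fst y)) (snd y), ?_⟩,
      ⟨fun y => ZFSet.pair (snd (fst y)) (snd y), ?_⟩⟩
    · rw [hk.ap_pair _ _ habc, hk.ap_snd hab hc, ← hk.ap_ap fst fst habc, hk.ap_fst hab hc,
        hk.ap_fst ha' hb']
    · rw [hk.ap_pair _ _ habc, hk.ap_snd hab hc, ← hk.ap_ap fst snd habc, hk.ap_fst hab hc,
        hk.ap_snd ha' hb']

theorem exists_enum {x y : ZFSet.{u}} (h : y.card ≤ x.card) :
    ∃ g : ZFSet.{u} → ZFSet.{u}, ∀ b ∈ y, ∃ a ∈ x, g a = b := by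
  by_cases hy : ∃ b, b ∈ y
  · obtain ⟨g, -, hg⟩ := exists_surjOn_of_card_le h hy
    exact ⟨g, hg⟩
  · exact ⟨id, fun b hb => (hy ⟨b, hb⟩).elim⟩

/-- A weak cover can be taken inside the image of a single set of small sets. -/
theorem UniverseEmbedding.WeakCovering.exists_mem_app {i : UniverseEmbedding.{u}}
    {κ : Cardinal.{u}} {l : Ordinal.{u}} (h : i.WeakCovering κ.ord l) :
    ∃ s ∈ i.app (ZFSet.sep (fun x => x.card < κ) (ZFSet.powerset l.toZFSet)),
      ∀ a < l, i.app a.toZFSet ∈ s := by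
  obtain ⟨s, hsM, hs, α, hα, f, hfM, hf, hinj⟩ := h
  set D := ZFSet.sep (fun x => x.card < κ) (ZFSet.powerset l.toZFSet)
  -- In V, a set that injects into an element of κ meets l in an element of `D`; elementarity
  -- transfers this to the given `s`. Membership in i(D) later places the image of the cover in
  -- k(D).
  have key := i.forall_mem_of_forall (n := 3) (m := 2)
    (fun v => (∃ a ∈ v (.inl 0), ZFSet.IsFunc (v (.inr 0)) a (v (.inr 1))) →
      (∀ x z, ZFSet.pair x z ∈ v (.inr 1) → ∀ y z', ZFSet.pair y z' ∈ v (.inr 1) →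
        z = z' → x = y) →
      ∃ y ∈ v (.inl 2), ∀ t ∈ v (.inl 1), t ∈ v (.inr 0) → t ∈ y)
    ![κ.ord.toZFSet, l.toZFSet, D] ?_ ![s, f] ?_ ⟨α, hα, hf⟩
    (fun x z hx y z' hy e => hinj x y z hx (e ▸ hy))
  · obtain ⟨y, hy, hy'⟩ := key
    exact ⟨y, hy, fun a ha =>
      hy' _ (i.preservesAbsolute.mem_iff.2 (Ordinal.toZFSet_mem_toZFSet_iff.2 ha)) (hs a ha)⟩
  · rintro w ⟨a, ha, hf⟩ hinj
    have h₁ := card_le_of_isFunc hf fun x y z hx hy => hinj x z hx y z hy rfl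
    have h₂ : a.card < κ := by
      obtain ⟨b, hb, rfl⟩ := Ordinal.mem_toZFSet_iff.1 (show a ∈ κ.ord.toZFSet from ha)
      rw [Ordinal.card_toZFSet]
      exact Cardinal.lt_ord.1 hb
    refine ⟨w 0 ∩ l.toZFSet, ?_, fun t ht ht' => ZFSet.mem_inter.2 ⟨ht', ht⟩⟩
    change w 0 ∩ l.toZFSet ∈ D
    refine ZFSet.mem_sep.2 ⟨ZFSet.mem_powerset.2 fun t ht => (ZFSet.mem_inter.1 ht).2, ?_⟩
    exact (ZFSet.card_mono fun t ht => (ZFSet.mem_inter.1 ht).1).trans_lt (h₁.trans_lt h₂)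
  · intro n
    fin_cases n
    exacts [hsM, hfM]

end WoodinSC

/-! ### The composite embedding and its covering property -/

namespace WoodinSC

open scoped ZFSet
open PreservesAbsolute

/-- The hull of k = j ∘ i is generated by Q, the k-version of V_{j(κ)+ω}, together with the cover b
= j(s) as a parameter. Both Q and b are smaller than k(κ) in the sense of k, and every element of
the target is a function of a point of Q and that parameter. -/
theorem exists_isStrongCompactness {i j : UniverseEmbedding.{u}} {κ : Cardinal.{u}}
    {l : Ordinal.{u}} (hκl : κ.ord ≤ l) (hic : i.HasCrit κ.ord)
    (hil : l.toZFSet ∈ i.app κ.ord.toZFSet) (hiw : i.WeakCovering κ.ord l)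
    (hjc : j.HasCrit κ.ord) (hjl : l.toZFSet ∈ j.app κ.ord.toZFSet) :
    ∃ J : UniverseEmbedding.{u}, J.IsStrongCompactness κ.ord l ∧
      ∀ A, ∀ a < l, a.toZFSet ∈ J.app A ↔ a.toZFSet ∈ j.app A := by
  have hi := i.preservesAbsolute
  have hj := j.preservesAbsolute
  set κs := κ.ord.toZFSet with hκs
  have hOrd : κs.IsOrdinal := ZFSet.isOrdinal_toZFSet _
  have hiκ : κs ∈ i.app κs := by
    rcases hκl.eq_or_lt with h | h
    · rw [hκs, h]; rw [hκs] at hil; rw [h] at hil; exact hil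
    · exact (hi.isOrdinal hOrd).mem_trans (Ordinal.toZFSet_mem_toZFSet_iff.2 h) hil
  have hjlt : ∀ a ≤ l, a.toZFSet ∈ j.app κs := by
    intro a ha
    rcases ha.eq_or_lt with rfl | h
    · exact hjl
    · exact (hj.isOrdinal hOrd).mem_trans (Ordinal.toZFSet_mem_toZFSet_iff.2 h) hjl
  set k : ZFSet.{u} → ZFSet.{u} := j.app ∘ i.app with hkdef
  have hk : PreservesAbsolute k := hj.comp hi
  have hjk : j.app κs ∈ k κs := hj.mem_iff.2 hiκ
  have hjk' : ∃ D, j.app κs ∈ k D := ⟨_, hjk⟩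
  obtain ⟨s, hs, hsl⟩ := hiw.exists_mem_app
  set b := j.app s with hb
  have hbk : b ∈ k (ZFSet.sep (fun x => x.card < κ) (ZFSet.powerset l.toZFSet)) := hj.mem_iff.2 hs
  have hb' : ∃ D, b ∈ k D := ⟨_, hbk⟩
  have hbl : ∀ a < l, k a.toZFSet ∈ b := fun a ha => hj.mem_iff.2 (hsl a ha)
  -- Q contains j(κ), is transitive and is closed under pairs; hence ordinals up to l belong to the
  -- hull and are fixed by the collapse.
  set Q := ap k pairClosure (j.app κs) with hQ
  have hQ' : ∃ D, Q ∈ k D := hk.ap_exists_mem hjk'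
  have hQpair : ∀ x ∈ Q, ∀ y ∈ Q, ZFSet.pair x y ∈ Q :=
    hk.rel_ap (f := pairClosure) (g := id) (h := id)
      (fun v => ∀ x ∈ v 0, ∀ y ∈ v 0, ZFSet.pair x y ∈ v 0)
      (Ev.of_forall hk hjk' fun x _ hy _ hz => pair_mem_pairClosure hy hz)
  have hκQ : j.app κs ∈ Q := by
    have : ap k (fun x => x) (j.app κs) ∈ Q :=
      hk.rel_ap (f := pairClosure) (g := fun x => x) (h := id) (fun v => v 1 ∈ v 0)
        (Ev.of_forall hk hjk' mem_pairClosure)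
    rwa [hk.ap_id hjk'] at this
  have hQtrans : ∀ x ∈ Q, ∀ y ∈ x, y ∈ Q :=
    hk.rel_ap (f := pairClosure) (g := id) (h := id) (fun v => ∀ x ∈ v 0, ∀ y ∈ x, y ∈ v 0)
      (Ev.of_forall hk hjk' fun x y hy z hz => isTransitive_pairClosure x y hy hz)
  set c := ZFSet.pair b Q with hcdef
  have hc : ∃ D, c ∈ k D := hk.pair_exists_mem hb' hQ'
  set Z := {z | ∃ a ∈ Q, z = ZFSet.pair a c} with hZdef
  have hZ : IsGenerating k Z := isGenerating_pair hk hQ' ⟨_, hκQ⟩ hQpair hc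
  have hZmem : ∀ a ∈ Q, ZFSet.pair a c ∈ Z := fun a ha => ⟨a, ha, rfl⟩
  -- values of projections at generators
  have hfst : ∀ a ∈ Q, ∃ D, a ∈ k D := by
    intro a ha
    obtain ⟨D, hD⟩ := hZ.exists_mem _ (hZmem a ha)
    have h : ∀ p ∈ k D, ∀ x y, p = ZFSet.pair x y → x ∈ k (setImage fst D) :=
      (hk.iff ![D, setImage fst D] (fun v => ∀ p ∈ v 0, ∀ x y, p = ZFSet.pair x y → x ∈ v 1)).2 (by
        rintro p hp x y rfl
        exact mem_setImage.2 ⟨_, hp, fst_pair _ _⟩)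
    exact ⟨_, h _ hD _ _ rfl⟩
  have ap_fst' : ∀ a ∈ Q, ap k fst (ZFSet.pair a c) = a := fun a ha => hk.ap_fst (hfst a ha) hc
  have ap_snd' : ∀ a ∈ Q, ap k snd (ZFSet.pair a c) = c := fun a ha => hk.ap_snd (hfst a ha) hc
  have ap_fs : ∀ a ∈ Q, ap k (fun z => fst (snd z)) (ZFSet.pair a c) = b := fun a ha => by
    rw [← hk.ap_ap snd fst (hZ.exists_mem _ (hZmem a ha)), ap_snd' a ha, hk.ap_fst hb' hQ']
  have ap_ss : ∀ a ∈ Q, ap k (fun z => snd (snd z)) (ZFSet.pair a c) = Q := fun a ha => by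
    rw [← hk.ap_ap snd snd (hZ.exists_mem _ (hZmem a ha)), ap_snd' a ha, hk.ap_snd hb' hQ']
  have hQhull : ∀ a ∈ Q, a ∈ hull k Z := fun a ha => ⟨_, hZmem a ha, fst, ap_fst' a ha⟩
  have hlQ : ∀ a ≤ l, a.toZFSet ∈ Q := fun a ha => hQtrans _ hκQ _ (hjlt a ha)
  have hcol : ∀ a ≤ l, collapse (hull k Z) a.toZFSet = a.toZFSet := by
    intro a ha
    refine collapse_eq_self (ZFSet.isOrdinal_toZFSet a).isTransitive fun y hy => ?_
    obtain ⟨d, hd, rfl⟩ := Ordinal.mem_toZFSet_iff.1 hy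
    exact hQhull _ (hlQ d (hd.le.trans ha))
  have hExt := hZ.isExtensional
  have happ : ∀ x, hZ.embedding.app x = collapse (hull k Z) (k x) := hZ.embedding_app
  have hlJ : l.toZFSet ∈ hZ.embedding.app κs := by
    rw [happ, ← hcol l le_rfl, hExt.collapse_mem_iff (hQhull _ (hlQ l le_rfl))]
    exact (hk.isOrdinal hOrd).mem_trans hjl hjk
  refine ⟨hZ.embedding, ⟨⟨fun a ha => ?_, fun h => ?_⟩, hlJ, ?_⟩, fun A a ha => ?_⟩
  · rw [happ, hkdef, Function.comp_apply, hic.1 a ha, hjc.1 a ha]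
    exact hcol a (ha.le.trans hκl)
  · rw [hκs, h, Ordinal.toZFSet_mem_toZFSet_iff] at hlJ
    exact hκl.not_gt hlJ
  · intro X hXM hX
    have hX' : ∀ x ∈ X, ∃ f, ∃ a ∈ Q, x = collapse (hull k Z) (ap k f (ZFSet.pair a c)) := by
      intro x hx
      obtain ⟨y, ⟨z, ⟨a, ha, rfl⟩, f, rfl⟩, rfl⟩ := hXM x hx
      exact ⟨f, a, ha, rfl⟩
    choose! F hF using hX'
    obtain ⟨e, he⟩ := exists_enum (x := l.toZFSet) (y := X) (by simpa)
    -- With w = (b, Q), collect the values of all `F (e d)`, d ∈ b, at all generators (a, w), a ∈ Q.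
    -- Since b contains k(d) for every d < l, the extended Ψ at c covers X, and it has size at most
    -- |b|·|Q|.
    set Ψ : ZFSet.{u} → ZFSet.{u} := fun w =>
      setImage (fun p => F (e (fst p)) (ZFSet.pair (snd p) w)) ((fst w).prod (snd w)) with hΨ
    have hz₀ := hZmem _ (hlQ l le_rfl)
    set z₀ := ZFSet.pair l.toZFSet c with hz₀def
    have hz₀' := hZ.exists_mem _ hz₀
    have hT : ∀ a ∈ Q, ap k (fun z => Ψ (snd z)) (ZFSet.pair a c) = ap k Ψ c := fun a ha => by
      rw [← hk.ap_ap snd Ψ (hZ.exists_mem _ (hZmem a ha)), ap_snd' a ha]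
    have hThull : ap k Ψ c ∈ hull k Z := by
      rw [← hT _ (hlQ l le_rfl)]
      exact ⟨_, hz₀, _, rfl⟩
    refine ⟨collapse (hull k Z) (ap k Ψ c), ⟨_, hThull, rfl⟩, fun x hx => ?_, ?_⟩
    · obtain ⟨a, ha, hxa⟩ := hF x hx
      obtain ⟨d, hd, rfl⟩ := he x hx
      have hz := hZmem a ha
      have hz' := hZ.exists_mem _ hz
      rw [hxa, hExt.collapse_mem_iff ⟨_, hz, _, rfl⟩, ← hT a ha, hk.ap_mem_ap_iff hz']
      have h₁ : Ev k (ZFSet.pair a c) fun z => d ∈ fst (snd z) := by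
        rw [← hk.ap_mem_ap_iff (f := fun _ => d) hz', hk.ap_const d hz', ap_fs a ha]
        obtain ⟨o, ho, rfl⟩ := Ordinal.mem_toZFSet_iff.1 hd
        exact hbl o ho
      have h₂ : Ev k (ZFSet.pair a c) fun z => fst z ∈ snd (snd z) := by
        rw [← hk.ap_mem_ap_iff hz', ap_fst' a ha, ap_ss a ha]
        exact ha
      have h₃ : Ev k (ZFSet.pair a c) fun z => ZFSet.pair (fst z) (snd z) = z := by
        rw [← hk.ap_eq_ap_iff hz', hk.ap_pair _ _ hz', ap_fst' a ha, ap_snd' a ha, hk.ap_id hz']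
      refine Ev.mono hk (Ev.and hk h₁ (Ev.and hk h₂ h₃)) ?_
      rintro z ⟨h₁, h₂, h₃⟩
      rw [hΨ]
      refine mem_setImage.2 ⟨ZFSet.pair d (fst z), ZFSet.pair_mem_prod.2 ⟨h₁, h₂⟩, ?_⟩
      rw [fst_pair, snd_pair, h₃]
    · have h₁ : Ev k z₀ fun z => (fst (snd z)).card < κ := by
        rw [← hk.ev_ap_iff (P := fun x => x.card < κ) hz₀', ap_fs _ (hlQ l le_rfl)]
        exact ⟨_, hbk⟩
      have hjκ := hjlt _ hκl
      -- Because j(κ) ∈ k(κ), it is enough that |V_{a+ω}| < κ for all a < κ.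
      have h₂ : Ev k z₀ fun z => (snd (snd z)).card < κ := by
        rw [← hk.ev_ap_iff (P := fun x => x.card < κ) hz₀', ap_ss _ (hlQ l le_rfl), hQ,
          hk.ev_ap_iff hjk']
        refine ⟨κs, ?_⟩
        convert hjk using 2
        ext x
        rw [ZFSet.mem_sep, and_iff_left_iff_imp]
        intro hx
        obtain ⟨a, ha, rfl⟩ := Ordinal.mem_toZFSet_iff.1 hx
        rw [pairClosure, Ordinal.rank_toZFSet]
        exact hjc.card_vonNeumann_lt hjκ (hjc.add_omega0_lt hjκ ha)
      have hinj : ∀ x : ZFSet.{u}, ∃ g : ZFSet.{u} → ZFSet.{u},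
          (∀ a ∈ x, g a ∈ x.card.ord.toZFSet) ∧ ∀ a ∈ x, ∀ b ∈ x, g a = g b → a = b :=
        fun x => exists_injOn_of_card_le (by simp)
      choose g hg hg' using hinj
      have h₃ := (hZ.absolute_collapse_iff
        (fun v : Fin 4 → ZFSet.{u} => v 0 ∈ v 1 ∧ ZFSet.IsFunc (v 2) (v 0) (v 3) ∧
          ∀ x z, ZFSet.pair x z ∈ v 3 → ∀ y z', ZFSet.pair y z' ∈ v 3 → z = z' → x = y) hz₀
        ![fun z => (Ψ (snd z)).card.ord.toZFSet, fun _ => κs, fun z => Ψ (snd z),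
          fun z => graph (g (Ψ (snd z))) (Ψ (snd z))]).2 (by
          refine Ev.mono hk (Ev.and hk h₁ h₂) ?_
          rintro z ⟨h₁, h₂⟩
          have h₃ : (Ψ (snd z)).card < κ := by
            refine (card_setImage_le _ _).trans_lt ?_
            rw [card_prod]
            exact Cardinal.mul_lt_of_lt (hjc.aleph0_lt hjκ).le h₁ h₂
          refine ⟨Ordinal.toZFSet_mem_toZFSet_iff.2 (Cardinal.ord_lt_ord.2 h₃), ⟨?_, ?_⟩, ?_⟩
          · intro p hp
            obtain ⟨d, rfl⟩ := ZFSet.mem_range.1 hp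
            exact ZFSet.pair_mem_prod.2 ⟨d.2, hg _ _ d.2⟩
          · intro x hx
            exact ⟨g (Ψ (snd z)) x, pair_mem_graph.2 ⟨hx, rfl⟩,
              fun y hy => (pair_mem_graph.1 hy).2.symm⟩
          · rintro x y hx x' y' hx' rfl
            obtain ⟨hx, e⟩ := pair_mem_graph.1 hx
            obtain ⟨hx', e'⟩ := pair_mem_graph.1 hx'
            exact hg' _ _ hx _ hx' (e.trans e'.symm))
      obtain ⟨h₄, h₅, h₆⟩ := h₃
      simp only [Matrix.cons_val] at h₄ h₅ h₆
      rw [hk.ap_const κs hz₀'] at h₄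
      rw [hT _ (hlQ l le_rfl)] at h₅
      exact ⟨_, h₄, _, ⟨_, ⟨_, hz₀, _, rfl⟩, rfl⟩, h₅,
        fun x y z hx hy => h₆ x z hx y z hy rfl⟩
  · rw [happ, ← hcol a ha.le, hExt.collapse_mem_iff (hQhull _ (hlQ a ha.le)), hcol a ha.le]
    -- A and i(A) agree below κ; applying j makes j(A) and k(A) agree below j(κ), which exceeds l.
    have h₀ : ∀ x ∈ κs, x ∈ A ↔ x ∈ i.app A := by
      intro x hx
      conv_rhs => rw [← hic.app_eq hx]
      exact hi.mem_iff.symm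
    have h : ∀ x ∈ j.app κs, x ∈ j.app A ↔ x ∈ j.app (i.app A) :=
      (hj.iff ![κs, A, i.app A] (fun v => ∀ x ∈ v 0, x ∈ v 1 ↔ x ∈ v 2)).2 h₀
    exact (h _ (hjlt a ha.le)).symm

end WoodinSC

/-! ### From pairs to one set, and from strongness to pairs -/

namespace WoodinSC

open scoped ZFSet

theorem inter_toZFSet_eq_iff {A B : ZFSet.{u}} {l : Ordinal.{u}} :
    A ∩ l.toZFSet = B ∩ l.toZFSet ↔ ∀ a < l, a.toZFSet ∈ A ↔ a.toZFSet ∈ B := by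
  constructor
  · intro h a ha
    have := congrArg (a.toZFSet ∈ ·) h
    simpa [ha] using this
  · intro h
    ext x
    simp only [ZFSet.mem_inter, and_congr_left_iff]
    intro hx
    obtain ⟨a, ha, rfl⟩ := Ordinal.mem_toZFSet_iff.1 hx
    exact h a ha

theorem PreservesAbsolute.map_singleton {k : ZFSet.{u} → ZFSet.{u}} (hk : PreservesAbsolute k)
    (x : ZFSet.{u}) : k {x} = {k x} := by
  have : ∀ y : ZFSet.{u}, ({y} : ZFSet.{u}) = insert y ∅ := fun y => by ext; simp
  rw [this, hk.map_insert, hk.map_empty, ← this]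

theorem PreservesAbsolute.mem_of_lt_of_mem {k : ZFSet.{u} → ZFSet.{u}} (hk : PreservesAbsolute k)
    {a b c : Ordinal.{u}} (hab : a ≤ b) (hb : b.toZFSet ∈ k c.toZFSet) :
    a.toZFSet ∈ k c.toZFSet := by
  rcases hab.eq_or_lt with rfl | h
  · exact hb
  · exact (hk.isOrdinal (ZFSet.isOrdinal_toZFSet c)).mem_trans
      (Ordinal.toZFSet_mem_toZFSet_iff.2 h) hb

theorem strongCompactFor_of_pair {κ δ : Cardinal.{u}} (hδ : Cardinal.aleph0 ≤ δ) {A : ZFSet.{u}}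
    (h : IsLTStronglyCompactForPair κ δ A A) : IsLTStronglyCompactFor κ δ A := by
  intro l hl hlδ
  -- The pair version speaks only of ordinals strictly above κ, so l = κ is reached through l + 1.
  obtain ⟨j, ⟨hc, hlj, hcov⟩, hA, -⟩ := h (l + 1) (Order.lt_add_one_iff.2 hl)
    ((Cardinal.isSuccLimit_ord hδ).succ_lt hlδ)
  have hle : l ≤ l + 1 := (lt_add_one l).le
  refine ⟨j, ⟨hc, j.preservesAbsolute.mem_of_lt_of_mem hle hlj, ?_⟩, ?_⟩
  · exact fun X hX hX' => hcov X hX (hX'.trans (Ordinal.card_le_card hle))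
  · rw [inter_toZFSet_eq_iff] at hA ⊢
    exact fun a ha => hA a (ha.trans_le hle)

theorem rank_pair_lt_add {x y : ZFSet.{u}} {l : Ordinal.{u}} (hx : x.rank < l) (hy : y.rank < l) :
    (ZFSet.pair x y).rank < l + 1 + 1 := by
  have hx' := Order.succ_le_of_lt hx
  have hy' := Order.succ_le_of_lt hy
  simp only [ZFSet.pair, ZFSet.rank_pair, ZFSet.rank_singleton]
  rw [Order.lt_add_one_iff]
  exact max_le (Order.succ_le_succ hx') (Order.succ_le_succ (max_le hx' hy'))

theorem strongCompactForPair_of_strong {δ : Cardinal.{u}} (hδ : Cardinal.aleph0 ≤ δ)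
    (h : ∀ A : ZFSet.{u}, A ⊆ V_ δ.ord →
      ∃ κ : Cardinal.{u}, κ < δ ∧ IsLTStronglyCompact κ δ ∧ IsLTStrongFor κ δ A)
    {A₁ A₂ : ZFSet.{u}} (hA₁ : A₁ ⊆ δ.ord.toZFSet) (hA₂ : A₂ ⊆ δ.ord.toZFSet) :
    ∃ κ : Cardinal.{u}, κ < δ ∧ IsLTStronglyCompactForPair κ δ A₁ A₂ := by
  have hlim := Cardinal.isSuccLimit_ord hδ
  set A : ZFSet.{u} := ZFSet.prod {∅} A₁ ∪ ZFSet.prod {{∅}} A₂ with hA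
  have hne : (∅ : ZFSet.{u}) ≠ {∅} := fun e =>
    ZFSet.not_nonempty_empty (by rw [e]; exact ZFSet.singleton_nonempty ∅)
  have h0 : (∅ : ZFSet.{u}).rank < Ordinal.omega0 := by simp
  have h1 : ({∅} : ZFSet.{u}).rank < Ordinal.omega0 := by simp
  have hω : Ordinal.omega0 ≤ δ.ord := Cardinal.omega0_le_ord.2 hδ
  have hrank : ∀ B : ZFSet.{u}, B ⊆ δ.ord.toZFSet → ∀ x ∈ B, x.rank < δ.ord := by
    intro B hB x hx
    obtain ⟨a, ha, rfl⟩ := Ordinal.mem_toZFSet_iff.1 (hB hx)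
    simpa
  obtain ⟨κ, hκ, hsc, hst⟩ := h A (by
    intro x hx
    rw [ZFSet.mem_vonNeumann]
    rcases ZFSet.mem_union.1 hx with hx | hx
    · obtain ⟨t, ht, b, hb, rfl⟩ := ZFSet.mem_prod.1 hx
      rw [ZFSet.mem_singleton] at ht
      subst ht
      exact rank_pair_lt hlim (h0.trans_le hω) (hrank _ hA₁ b hb)
    · obtain ⟨t, ht, b, hb, rfl⟩ := ZFSet.mem_prod.1 hx
      rw [ZFSet.mem_singleton] at ht
      subst ht
      exact rank_pair_lt hlim (h1.trans_le hω) (hrank _ hA₂ b hb))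
  refine ⟨κ, hκ, fun l hl hlδ => ?_⟩
  have hll : l ≤ l + 1 + 1 := (lt_add_one l).le.trans (lt_add_one _).le
  -- Tagging an ordinal below l by ∅ or {∅} costs at most two ranks.
  obtain ⟨j, ⟨hjc, hjl, -⟩, hjA⟩ := hst (l + 1 + 1) (hl.le.trans hll)
    (hlim.succ_lt (hlim.succ_lt hlδ))
  obtain ⟨i, hic, hil, hiw⟩ := hsc l hl.le hlδ
  have hj := j.preservesAbsolute
  have hjl' := hj.mem_of_lt_of_mem hll hjl
  have hωl : Ordinal.omega0 < l := (hjc.omega0_lt (hj.mem_of_lt_of_mem hl.le hjl')).trans hl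
  obtain ⟨J, hJ, hJA⟩ := exists_isStrongCompactness hl.le hic hil hiw hjc hjl'
  have hmem : ∀ t a : ZFSet.{u}, t.rank < l → a.rank < l →
      (ZFSet.pair t a ∈ A ↔ ZFSet.pair t a ∈ j.app A) := by
    intro t a ht ha
    have h := congrArg (ZFSet.pair t a ∈ ·) hjA
    have hV : ZFSet.pair t a ∈ V_ (l + 1 + 1) := ZFSet.mem_vonNeumann.2 (rank_pair_lt_add ht ha)
    simpa only [ZFSet.mem_inter, hV, and_true, eq_iff_iff] using h
  refine ⟨J, hJ, ?_, ?_⟩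
  · rw [inter_toZFSet_eq_iff]
    intro a ha
    have h₂ := hmem ∅ a.toZFSet (h0.trans hωl) (by simpa)
    rw [hA, hj.mem_union_iff, ZFSet.mem_union, hj.pair_mem_prod_iff, hj.pair_mem_prod_iff,
      hj.map_singleton, hj.map_singleton, hj.map_singleton, hj.map_empty] at h₂
    rw [hJA A₁ a ha]
    simpa [ZFSet.pair_mem_prod, hne] using h₂
  · rw [inter_toZFSet_eq_iff]
    intro a ha
    have h₂ := hmem {∅} a.toZFSet (h1.trans hωl) (by simpa)
    rw [hA, hj.mem_union_iff, ZFSet.mem_union, hj.pair_mem_prod_iff, hj.pair_mem_prod_iff,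
      hj.map_singleton, hj.map_singleton, hj.map_singleton, hj.map_empty] at h₂
    rw [hJA A₂ a ha]
    simpa [ZFSet.pair_mem_prod, hne.symm] using h₂

end WoodinSC

/-! ### Gödel pairing and a coding of sets by ordinals -/

namespace WoodinSC

open scoped ZFSet

/-- A well-order with small initial segments is isomorphic to an initial segment of the
ordinals. -/
theorem exists_ordinal_collapse {α : Type (u + 1)} (r : α → α → Prop) [IsWellOrder α r]
    (b : α → Cardinal.{u}) (hb : ∀ x, Cardinal.mk {y // r y x} ≤ Cardinal.lift.{u + 1} (b x)) :
    ∃ c : α → Ordinal.{u}, (∀ x y, c x < c y ↔ r x y) ∧ (∀ x, ∀ o < c x, ∃ y, r y x ∧ c y = o) ∧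
      ∀ x, (c x).card ≤ b x := by
  -- Order types of this class-sized order live one universe up; the bound on initial segments
  -- brings them back down.
  have h : ∀ x, ∃ o : Ordinal.{u}, Ordinal.lift.{u + 1} o = Ordinal.typein r x := by
    intro x
    exact Ordinal.mem_range_lift_of_card_le.{u, u + 1} (a := b x) (hb x)
  choose c hc using h
  have hlt : ∀ x y, c x < c y ↔ r x y := by
    intro x y
    rw [← Ordinal.typein_lt_typein r, ← hc, ← hc, Ordinal.lift_lt]
  refine ⟨c, hlt, fun x o ho => ?_, fun x => ?_⟩
  · have h₁ : Ordinal.lift.{u + 1} o < Ordinal.typein r x := by rwa [← hc, Ordinal.lift_lt]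
    obtain ⟨y, hy⟩ := Ordinal.typein_surj r (h₁.trans (Ordinal.typein_lt_type r x))
    have : c y = o := by rw [← Ordinal.lift_inj.{u + 1}, hc, hy]
    exact ⟨y, (hlt y x).1 (this ▸ ho), this⟩
  · rw [← Cardinal.lift_le.{u + 1}, Ordinal.lift_card, hc]
    exact hb x

/-- The canonical well-order of pairs of ordinals. -/
def PairLT (a b a' b' : Ordinal.{u}) : Prop :=
  max a b < max a' b' ∨ max a b = max a' b' ∧ (a < a' ∨ a = a' ∧ b < b')

/-- `p` is the canonical pairing function on ordinals. -/
structure IsPairing (p : Ordinal.{u} → Ordinal.{u} → Ordinal.{u}) : Prop where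
  lt_iff : ∀ a b a' b', p a b < p a' b' ↔ PairLT a b a' b'
  surj : ∀ a b, ∀ o < p a b, ∃ a' b', PairLT a' b' a b ∧ p a' b' = o
  card_le : ∀ a b, (p a b).card ≤ (max a b + 1).card * (max a b + 1).card

theorem exists_isPairing : ∃ p : Ordinal.{u} → Ordinal.{u} → Ordinal.{u}, IsPairing p := by
  let key : Ordinal.{u} × Ordinal.{u} → Ordinal.{u} ×ₗ (Ordinal.{u} ×ₗ Ordinal.{u}) :=
    fun q => toLex (max q.1 q.2, toLex (q.1, q.2))
  have hkey : Function.Injective key := by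
    rintro ⟨a, b⟩ ⟨a', b'⟩ h
    simp only [key, EmbeddingLike.apply_eq_iff_eq, Prod.mk.injEq] at h
    exact Prod.ext h.2.1 h.2.2
  let r : Ordinal.{u} × Ordinal.{u} → Ordinal.{u} × Ordinal.{u} → Prop :=
    fun x y => key x < key y
  have hr : ∀ a b a' b', r (a, b) (a', b') ↔ PairLT a b a' b' := by
    intro a b a' b'
    simp only [r, key, PairLT, Prod.Lex.toLex_lt_toLex]
  have : IsWellOrder _ r :=
    (RelEmbedding.preimage ⟨key, hkey⟩ (· < ·)).isWellOrder
  obtain ⟨c, h₁, h₂, h₃⟩ := exists_ordinal_collapse r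
    (fun x => (max x.1 x.2 + 1).card * (max x.1 x.2 + 1).card) (by
      rintro ⟨a, b⟩
      rw [Cardinal.lift_mul, ← Cardinal.mk_Iio_ordinal, Cardinal.mul_def]
      have hmem : ∀ y : {y // r y (a, b)}, y.1.1 < max a b + 1 ∧ y.1.2 < max a b + 1 := by
        rintro ⟨⟨a', b'⟩, hy⟩
        have hle : max a' b' ≤ max a b := by
          rcases (hr _ _ _ _).1 hy with h | h
          exacts [h.le, h.1.le]
        rw [Order.lt_add_one_iff, Order.lt_add_one_iff]
        exact ⟨(le_max_left _ _).trans hle, (le_max_right _ _).trans hle⟩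
      refine Cardinal.mk_le_of_injective
        (f := fun y : {y // r y (a, b)} =>
          ((⟨y.1.1, (hmem y).1⟩, ⟨y.1.2, (hmem y).2⟩) :
            Set.Iio (max a b + 1) × Set.Iio (max a b + 1))) ?_
      rintro ⟨⟨a', b'⟩, hy⟩ ⟨⟨a'', b''⟩, hy'⟩ h
      simp only [Prod.mk.injEq] at h
      exact Subtype.ext (Prod.ext (Subtype.mk.inj h.1) (Subtype.mk.inj h.2)))
  refine ⟨fun a b => c (a, b), fun a b a' b' => (h₁ _ _).trans (hr _ _ _ _), fun a b o ho => ?_,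
    fun a b => h₃ (a, b)⟩
  obtain ⟨⟨a', b'⟩, h, e⟩ := h₂ _ o ho
  exact ⟨a', b', (hr _ _ _ _).1 h, e⟩

theorem IsPairing.inj {p : Ordinal.{u} → Ordinal.{u} → Ordinal.{u}} (hp : IsPairing p)
    {a b a' b' : Ordinal.{u}} (h : p a b = p a' b') : a = a' ∧ b = b' := by
  have h₁ := (hp.lt_iff a b a' b').not.1 h.not_lt
  have h₂ := (hp.lt_iff a' b' a b).not.1 h.not_gt
  unfold PairLT at h₁ h₂
  rcases lt_trichotomy (max a b) (max a' b') with h | h | h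
  · exact (h₁ (.inl h)).elim
  · rcases lt_trichotomy a a' with h' | rfl | h'
    · exact (h₁ (.inr ⟨h, .inl h'⟩)).elim
    · rcases lt_trichotomy b b' with h'' | rfl | h''
      · exact (h₁ (.inr ⟨h, .inr ⟨rfl, h''⟩⟩)).elim
      · exact ⟨rfl, rfl⟩
      · exact (h₂ (.inr ⟨h.symm, .inr ⟨rfl, h''⟩⟩)).elim
    · exact (h₂ (.inr ⟨h.symm, .inl h'⟩)).elim
  · exact (h₂ (.inl h)).elim

theorem IsPairing.lt_of_lt {p : Ordinal.{u} → Ordinal.{u} → Ordinal.{u}} (hp : IsPairing p)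
    {a b c : Ordinal.{u}} (ha : a < c) (hb : b < c) : p a b < p c c :=
  (hp.lt_iff _ _ _ _).2 (.inl (by rw [max_self]; exact max_lt ha hb))

theorem IsPairing.lt_ord {p : Ordinal.{u} → Ordinal.{u} → Ordinal.{u}} (hp : IsPairing p)
    {δ : Cardinal.{u}} (hδ : Cardinal.aleph0 ≤ δ) {a b : Ordinal.{u}} (ha : a < δ.ord)
    (hb : b < δ.ord) : p a b < δ.ord := by
  rw [Cardinal.lt_ord]
  have h := Cardinal.lt_ord.1 ((Cardinal.isSuccLimit_ord hδ).add_one_lt (max_lt ha hb))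
  exact (hp.card_le a b).trans_lt (Cardinal.mul_lt_of_lt hδ h h)

/-- Sets are ordered by rank, ties being broken by an arbitrary well-order. The predecessors of x
lie in V_{rank x + 1}, so initial segments are sets. -/
theorem exists_ranked_coding : ∃ c : ZFSet.{u} → Ordinal.{u}, Function.Injective c ∧
    (∀ x y : ZFSet.{u}, x.rank < y.rank → c x < c y) ∧
    ∀ x : ZFSet.{u}, (c x).card ≤ (V_ (x.rank + 1)).card := by
  let s := Prod.Lex (α := Ordinal.{u}) (β := ZFSet.{u}) (· < ·) WellOrderingRel
  let key : ZFSet.{u} ↪ Ordinal.{u} × ZFSet.{u} :=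
    ⟨fun x => (x.rank, x), fun x y h => congrArg Prod.snd h⟩
  let r : ZFSet.{u} → ZFSet.{u} → Prop := fun x y => s (key x) (key y)
  have : IsWellOrder _ s := inferInstanceAs (IsWellOrder _ (Prod.Lex _ _))
  have : IsWellOrder _ r := (RelEmbedding.preimage key s).isWellOrder
  obtain ⟨c, h₁, h₂, h₃⟩ := exists_ordinal_collapse r (fun x => (V_ (x.rank + 1)).card) (by
    intro x
    rw [← ZFSet.cardinalMk_coe_sort]
    refine Cardinal.mk_le_of_injective
      (f := fun y : {y // r y x} => (⟨y.1, ?_⟩ : (V_ (x.rank + 1) : ZFSet.{u}))) ?_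
    · rw [ZFSet.mem_vonNeumann, Order.lt_add_one_iff]
      rcases Prod.lex_def.1 y.2 with h | h
      exacts [h.le, h.1.le]
    · intro y z h
      exact Subtype.ext (Subtype.mk.inj h))
  refine ⟨c, fun x y h => ?_, fun x y h => (h₁ x y).2 (Prod.lex_def.2 (.inl h)), h₃⟩
  rcases trichotomous_of r x y with h' | h' | h'
  · exact (h.not_lt ((h₁ x y).2 h')).elim
  · exact h'
  · exact (h.not_gt ((h₁ y x).2 h')).elim

end WoodinSC

/-! ### Absoluteness of the pairing function -/

namespace WoodinSC

open scoped ZFSet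
open PreservesAbsolute

/-- `PairLT` for von Neumann ordinals. -/
def PairMem (a b a' b' : ZFSet.{u}) : Prop :=
  ((a ∈ a' ∨ a ∈ b') ∧ (b ∈ a' ∨ b ∈ b')) ∨
    (¬ ((a' ∈ a ∨ a' ∈ b) ∧ (b' ∈ a ∨ b' ∈ b)) ∧ (a ∈ a' ∨ (a = a' ∧ b ∈ b')))

instance {ι : Type} (i j k l : ι) :
    IsAbsolute fun v : ι → ZFSet.{u} => PairMem (v i) (v j) (v k) (v l) := by
  unfold PairMem
  infer_instance

theorem pairMem_toZFSet_iff {a b a' b' : Ordinal.{u}} :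
    PairMem a.toZFSet b.toZFSet a'.toZFSet b'.toZFSet ↔ PairLT a b a' b' := by
  simp only [PairMem, PairLT, Ordinal.toZFSet_mem_toZFSet_iff, Ordinal.toZFSet_injective.eq_iff]
  rw [← lt_max_iff, ← lt_max_iff, ← lt_max_iff, ← lt_max_iff, ← max_lt_iff, ← max_lt_iff, not_lt]
  constructor
  · rintro (h | ⟨h, h'⟩)
    · exact .inl h
    · rcases h.lt_or_eq with h | h
      exacts [.inl h, .inr ⟨h, h'⟩]
  · rintro (h | ⟨h, h'⟩)
    · exact .inl h
    · exact .inr ⟨h.le, h'⟩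

/-- The restriction of `p` to `d`, as a set of pairs. -/
noncomputable def pairingSet (p : Ordinal.{u} → Ordinal.{u} → Ordinal.{u}) (d : Ordinal.{u}) :
    ZFSet.{u} :=
  graph (fun z => (p (fst z).rank (snd z).rank).toZFSet) (d.toZFSet.prod d.toZFSet)

variable {p : Ordinal.{u} → Ordinal.{u} → Ordinal.{u}} {d : Ordinal.{u}}

theorem mem_pairingSet {q w : ZFSet.{u}} : ZFSet.pair q w ∈ pairingSet p d ↔
    ∃ a < d, ∃ b < d, q = ZFSet.pair a.toZFSet b.toZFSet ∧ w = (p a b).toZFSet := by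
  rw [pairingSet, pair_mem_graph, ZFSet.mem_prod]
  constructor
  · rintro ⟨⟨_, ha, _, hb, rfl⟩, rfl⟩
    obtain ⟨a, ha', rfl⟩ := Ordinal.mem_toZFSet_iff.1 ha
    obtain ⟨b, hb', rfl⟩ := Ordinal.mem_toZFSet_iff.1 hb
    exact ⟨a, ha', b, hb', rfl, by simp⟩
  · rintro ⟨a, ha, b, hb, rfl, rfl⟩
    exact ⟨⟨_, Ordinal.toZFSet_mem_toZFSet_iff.2 ha, _, Ordinal.toZFSet_mem_toZFSet_iff.2 hb, rfl⟩,
      by simp⟩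

theorem pair_pair_mem_pairingSet {a b : Ordinal.{u}} (ha : a < d) (hb : b < d) :
    ZFSet.pair (ZFSet.pair a.toZFSet b.toZFSet) (p a b).toZFSet ∈ pairingSet p d :=
  mem_pairingSet.2 ⟨a, ha, b, hb, rfl, rfl⟩

variable (hp : IsPairing p) {k : ZFSet.{u} → ZFSet.{u}} (hk : PreservesAbsolute k)
include hk

theorem PreservesAbsolute.exists_of_mem {z : ZFSet.{u}} (hz : z ∈ k d.toZFSet) :
    ∃ a : Ordinal.{u}, z = a.toZFSet :=
  ⟨z.rank, ((hk.isOrdinal (ZFSet.isOrdinal_toZFSet d)).mem hz).toZFSet_rank_eq.symm⟩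

include hp

theorem IsPairing.mem_app_inj : ∀ q w, ZFSet.pair q w ∈ k (pairingSet p d) → ∀ q' w',
    ZFSet.pair q' w' ∈ k (pairingSet p d) → w = w' → q = q' := by
  have h₀ : ∀ q w, ZFSet.pair q w ∈ pairingSet p d → ∀ q' w',
      ZFSet.pair q' w' ∈ pairingSet p d → w = w' → q = q' := by
    rintro q w h q' w' h' e
    obtain ⟨a, -, b, -, rfl, rfl⟩ := mem_pairingSet.1 h
    obtain ⟨a', -, b', -, rfl, rfl⟩ := mem_pairingSet.1 h'
    obtain ⟨rfl, rfl⟩ := hp.inj (Ordinal.toZFSet_injective e)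
    rfl
  exact (hk.iff ![pairingSet p d] (fun v => ∀ q w, ZFSet.pair q w ∈ v 0 → ∀ q' w',
    ZFSet.pair q' w' ∈ v 0 → w = w' → q = q')).2 h₀

/-- The canonical pairing function is absolute. -/
theorem IsPairing.pair_pair_mem_app {a b : Ordinal.{u}} (ha : a.toZFSet ∈ k d.toZFSet)
    (hb : b.toZFSet ∈ k d.toZFSet) :
    ZFSet.pair (ZFSet.pair a.toZFSet b.toZFSet) (p a b).toZFSet ∈ k (pairingSet p d) := by
  set D := d.toZFSet with hD
  set P := pairingSet p d with hP
  have total : ∀ a ∈ k D, ∀ b ∈ k D, ∃ q w, ZFSet.pair q w ∈ k P ∧ q = ZFSet.pair a b := by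
    have h₀ : ∀ a ∈ D, ∀ b ∈ D, ∃ q w, ZFSet.pair q w ∈ P ∧ q = ZFSet.pair a b := by
      intro a ha b hb
      obtain ⟨a, ha', rfl⟩ := Ordinal.mem_toZFSet_iff.1 ha
      obtain ⟨b, hb', rfl⟩ := Ordinal.mem_toZFSet_iff.1 hb
      exact ⟨_, _, pair_pair_mem_pairingSet ha' hb', rfl⟩
    exact (hk.iff ![D, P] (fun v => ∀ a ∈ v 0, ∀ b ∈ v 0, ∃ q w, ZFSet.pair q w ∈ v 1 ∧
      q = ZFSet.pair a b)).2 h₀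
  have func : ∀ q w, ZFSet.pair q w ∈ k P → ∀ q' w', ZFSet.pair q' w' ∈ k P → q = q' → w = w' := by
    have h₀ : ∀ q w, ZFSet.pair q w ∈ P → ∀ q' w', ZFSet.pair q' w' ∈ P → q = q' → w = w' := by
      rintro q w h q' w' h' rfl
      rw [← (pair_mem_graph.1 h).2, ← (pair_mem_graph.1 h').2]
    exact (hk.iff ![P] (fun v => ∀ q w, ZFSet.pair q w ∈ v 0 → ∀ q' w',
      ZFSet.pair q' w' ∈ v 0 → q = q' → w = w')).2 h₀
  have down : ∀ q w, ZFSet.pair q w ∈ k P → ∀ a b, q = ZFSet.pair a b → ∀ z ∈ w,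
      ∃ a' ∈ k D, ∃ b' ∈ k D, PairMem a' b' a b ∧ ZFSet.pair (ZFSet.pair a' b') z ∈ k P := by
    have h₀ : ∀ q w, ZFSet.pair q w ∈ P → ∀ a b, q = ZFSet.pair a b → ∀ z ∈ w,
        ∃ a' ∈ D, ∃ b' ∈ D, PairMem a' b' a b ∧ ZFSet.pair (ZFSet.pair a' b') z ∈ P := by
      intro q w h a b e z hz
      obtain ⟨a, ha, b, hb, rfl, rfl⟩ := mem_pairingSet.1 h
      obtain ⟨rfl, rfl⟩ := ZFSet.pair_inj.1 e
      obtain ⟨o, ho, rfl⟩ := Ordinal.mem_toZFSet_iff.1 hz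
      obtain ⟨a', b', hlt, rfl⟩ := hp.surj a b o ho
      have hmax : max a' b' < d := by
        refine lt_of_le_of_lt ?_ (max_lt ha hb)
        rcases hlt with h | h
        exacts [h.le, h.1.le]
      have ha' := (le_max_left _ _).trans_lt hmax
      have hb' := (le_max_right _ _).trans_lt hmax
      exact ⟨_, Ordinal.toZFSet_mem_toZFSet_iff.2 ha', _, Ordinal.toZFSet_mem_toZFSet_iff.2 hb',
        pairMem_toZFSet_iff.2 hlt, pair_pair_mem_pairingSet ha' hb'⟩
    exact (hk.iff ![D, P] (fun v => ∀ q w, ZFSet.pair q w ∈ v 1 → ∀ a b, q = ZFSet.pair a b →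
      ∀ z ∈ w, ∃ a' ∈ v 0, ∃ b' ∈ v 0, PairMem a' b' a b ∧
        ZFSet.pair (ZFSet.pair a' b') z ∈ v 1)).2 h₀
  have up : ∀ q w, ZFSet.pair q w ∈ k P → ∀ a b, q = ZFSet.pair a b →
      ∀ q' w', ZFSet.pair q' w' ∈ k P → ∀ a' b', q' = ZFSet.pair a' b' →
      PairMem a' b' a b → w' ∈ w := by
    have h₀ : ∀ q w, ZFSet.pair q w ∈ P → ∀ a b, q = ZFSet.pair a b →
        ∀ q' w', ZFSet.pair q' w' ∈ P → ∀ a' b', q' = ZFSet.pair a' b' →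
        PairMem a' b' a b → w' ∈ w := by
      intro q w h a b e q' w' h' a' b' e' hlt
      obtain ⟨a, ha, b, hb, rfl, rfl⟩ := mem_pairingSet.1 h
      obtain ⟨a', ha', b', hb', rfl, rfl⟩ := mem_pairingSet.1 h'
      obtain ⟨rfl, rfl⟩ := ZFSet.pair_inj.1 e
      obtain ⟨rfl, rfl⟩ := ZFSet.pair_inj.1 e'
      rw [Ordinal.toZFSet_mem_toZFSet_iff, hp.lt_iff]
      exact pairMem_toZFSet_iff.1 hlt
    exact (hk.iff ![P] (fun v => ∀ q w, ZFSet.pair q w ∈ v 0 → ∀ a b, q = ZFSet.pair a b →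
      ∀ q' w', ZFSet.pair q' w' ∈ v 0 → ∀ a' b', q' = ZFSet.pair a' b' →
      PairMem a' b' a b → w' ∈ w)).2 h₀
  -- By `down` and `up`, the elements of a value of the extended function are exactly its values at
  -- smaller pairs. The same holds for p, so the two agree by induction on p a b.
  have main : ∀ o : Ordinal.{u}, ∀ a b, p a b = o → a.toZFSet ∈ k D → b.toZFSet ∈ k D →
      ZFSet.pair (ZFSet.pair a.toZFSet b.toZFSet) (p a b).toZFSet ∈ k P := by
    intro o
    induction o using WellFoundedLT.induction with
    | ind o ih =>
    rintro a b rfl ha hb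
    obtain ⟨q, w, hw, rfl⟩ := total _ ha _ hb
    have : w = (p a b).toZFSet := by
      ext z
      constructor
      · intro hz
        obtain ⟨a', ha', b', hb', hlt, hz'⟩ := down _ _ hw _ _ rfl z hz
        obtain ⟨a', rfl⟩ := hk.exists_of_mem ha'
        obtain ⟨b', rfl⟩ := hk.exists_of_mem hb'
        have hlt' := (hp.lt_iff _ _ _ _).2 (pairMem_toZFSet_iff.1 hlt)
        rw [func _ _ hz' _ _ (ih _ hlt' a' b' rfl ha' hb') rfl]
        exact Ordinal.toZFSet_mem_toZFSet_iff.2 hlt'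
      · intro hz
        obtain ⟨o, ho, rfl⟩ := Ordinal.mem_toZFSet_iff.1 hz
        obtain ⟨a', b', hlt, rfl⟩ := hp.surj a b o ho
        have hle : max a' b' ≤ max a b := by
          rcases hlt with h | h
          exacts [h.le, h.1.le]
        have hmax : (max a b).toZFSet ∈ k D := by
          rcases max_choice a b with h | h <;> rw [h] <;> assumption
        refine up _ _ hw _ _ rfl _ _ (ih _ ho a' b' rfl ?_ ?_) _ _ rfl
          (pairMem_toZFSet_iff.2 hlt)
        · exact hk.mem_of_lt_of_mem ((le_max_left _ _).trans hle) hmax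
        · exact hk.mem_of_lt_of_mem ((le_max_right _ _).trans hle) hmax
    exact this ▸ hw
  exact main _ a b rfl ha hb

end WoodinSC

/-! ### Recovering V_l from a set of ordinals -/

namespace WoodinSC

open scoped ZFSet
open PreservesAbsolute

/-- Use the ordinal a itself as the set. If κ ≤ a, then a ∈ j(κ) ⊆ j(a) although a ∉ a,
contradicting agreement below a + 1; so κ lies above a. -/
theorem exists_card_vonNeumann_lt {δ : Cardinal.{u}} (hδ : Cardinal.aleph0 ≤ δ)
    (h : ∀ A : ZFSet.{u}, A ⊆ δ.ord.toZFSet →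
      ∃ κ : Cardinal.{u}, κ < δ ∧ IsLTStronglyCompactFor κ δ A)
    {a : Ordinal.{u}} (ha : a < δ.ord) :
    ∃ κ : Cardinal.{u}, κ < δ ∧ a < κ.ord ∧ ∀ b < κ.ord, (V_ b).card < κ := by
  obtain ⟨κ, hκ, hsc⟩ := h a.toZFSet (Ordinal.toZFSet_monotone ha.le)
  have hlim := Cardinal.isSuccLimit_ord hδ
  obtain ⟨j, ⟨hc, hl, -⟩, hA⟩ := hsc (max κ.ord (a + 1)) (le_max_left _ _)
    (max_lt (Cardinal.ord_lt_ord.2 hκ) (hlim.add_one_lt ha))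
  have hj := j.preservesAbsolute
  refine ⟨κ, hκ, ?_, fun b hb =>
    hc.card_vonNeumann_lt (hj.mem_of_lt_of_mem (le_max_left _ _) hl) hb⟩
  by_contra! hle
  rw [inter_toZFSet_eq_iff] at hA
  have hlt : a < max κ.ord (a + 1) := lt_max_of_lt_right (lt_add_one a)
  refine (hA a hlt).not.1 (ZFSet.mem_irrefl _) ?_
  exact hj.subset_iff.2 (Ordinal.toZFSet_monotone hle) (hj.mem_of_lt_of_mem hlt.le hl)

theorem UniverseEmbedding.Covering.weakCovering {j : UniverseEmbedding.{u}} {κ l : Ordinal.{u}}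
    (h : j.Covering κ l) : j.WeakCovering κ l := by
  obtain ⟨s, hs, hXs, hcard⟩ := h (setImage j.app l.toZFSet) (fun x hx => by
    obtain ⟨y, -, rfl⟩ := mem_setImage.1 hx
    exact j.app_mem y) (by simpa using card_setImage_le j.app l.toZFSet)
  exact ⟨s, hs, fun a ha => hXs (mem_setImage.2
    ⟨_, Ordinal.toZFSet_mem_toZFSet_iff.2 ha, rfl⟩), hcard⟩

/-- The set of ordinals coding the membership relation on `V_ d` together with the subset `A`. -/
noncomputable def codeSet (p : Ordinal.{u} → Ordinal.{u} → Ordinal.{u})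
    (c : ZFSet.{u} → Ordinal.{u}) (d : Ordinal.{u}) (A : ZFSet.{u}) : ZFSet.{u} :=
  ZFSet.sep (fun w => (∃ x ∈ V_ d, ∃ y ∈ V_ d, (y ∈ x ∨ y = x) ∧ w = (p (c y) (c x)).toZFSet) ∨
    ∃ x ∈ A, w = (p 0 (c x)).toZFSet) d.toZFSet

section Coding

variable {p : Ordinal.{u} → Ordinal.{u} → Ordinal.{u}} {c : ZFSet.{u} → Ordinal.{u}}
  {d : Ordinal.{u}} {A : ZFSet.{u}} {k : ZFSet.{u} → ZFSet.{u}}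

/-- The coding of sets by ordinals, as a set. -/
noncomputable def codingGraph (c : ZFSet.{u} → Ordinal.{u}) (d : Ordinal.{u}) : ZFSet.{u} :=
  graph (fun x => (c x).toZFSet) (V_ d)

theorem mem_codingGraph {x a : ZFSet.{u}} :
    ZFSet.pair x a ∈ codingGraph c d ↔ x ∈ V_ d ∧ (c x).toZFSet = a := pair_mem_graph

/-- `c` codes the elements of `V_ d` by ordinals below `d`, with members before sets. -/
structure IsCoding (c : ZFSet.{u} → Ordinal.{u}) (d : Ordinal.{u}) : Prop where
  inj : Function.Injective c
  lt_of_mem : ∀ x y : ZFSet.{u}, y ∈ x → c y < c x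
  pos : ∀ x, 0 < c x
  lt : ∀ x ∈ V_ d, c x < d

variable (hk : PreservesAbsolute k)
include hk

theorem app_codeSet_cases (hc : IsCoding c d) (hA : A ⊆ V_ d) :
    ∀ w ∈ k (codeSet p c d A),
      (∃ x a, ZFSet.pair x a ∈ k (codingGraph c d) ∧ ∃ y b,
        ZFSet.pair y b ∈ k (codingGraph c d) ∧ (y ∈ x ∨ y = x) ∧
        ZFSet.pair (ZFSet.pair b a) w ∈ k (pairingSet p d)) ∨
      ∃ x a, ZFSet.pair x a ∈ k (codingGraph c d) ∧
        ZFSet.pair (ZFSet.pair (k ∅) a) w ∈ k (pairingSet p d) := by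
  have h₀ : ∀ w ∈ codeSet p c d A,
      (∃ x a, ZFSet.pair x a ∈ codingGraph c d ∧ ∃ y b,
        ZFSet.pair y b ∈ codingGraph c d ∧ (y ∈ x ∨ y = x) ∧
        ZFSet.pair (ZFSet.pair b a) w ∈ pairingSet p d) ∨
      ∃ x a, ZFSet.pair x a ∈ codingGraph c d ∧
        ZFSet.pair (ZFSet.pair ∅ a) w ∈ pairingSet p d := by
    intro w hw
    rcases (ZFSet.mem_sep.1 hw).2 with ⟨x, hx, y, hy, hyx, rfl⟩ | ⟨x, hx, rfl⟩
    · exact .inl ⟨x, _, mem_codingGraph.2 ⟨hx, rfl⟩, y, _, mem_codingGraph.2 ⟨hy, rfl⟩, hyx,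
        pair_pair_mem_pairingSet (hc.lt y hy) (hc.lt x hx)⟩
    · refine .inr ⟨x, _, mem_codingGraph.2 ⟨hA hx, rfl⟩, ?_⟩
      rw [← Ordinal.toZFSet_zero]
      have hxd := hc.lt x (hA hx)
      exact pair_pair_mem_pairingSet (zero_le.trans_lt hxd) hxd
  exact (hk.iff ![codeSet p c d A, codingGraph c d, pairingSet p d, ∅] (fun v => ∀ w ∈ v 0,
      (∃ x a, ZFSet.pair x a ∈ v 1 ∧ ∃ y b, ZFSet.pair y b ∈ v 1 ∧ (y ∈ x ∨ y = x) ∧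
        ZFSet.pair (ZFSet.pair b a) w ∈ v 2) ∨
      ∃ x a, ZFSet.pair x a ∈ v 1 ∧ ZFSet.pair (ZFSet.pair (v 3) a) w ∈ v 2)).2 h₀

theorem mem_app_codeSet (hd : ∀ a < d, ∀ b < d, p a b < d) :
    ∀ x a, ZFSet.pair x a ∈ k (codingGraph c d) → ∀ y b, ZFSet.pair y b ∈ k (codingGraph c d) →
      (y ∈ x ∨ y = x) → ∀ q w, ZFSet.pair q w ∈ k (pairingSet p d) → q = ZFSet.pair b a →
      w ∈ k (codeSet p c d A) := by
  have h₀ : ∀ x a, ZFSet.pair x a ∈ codingGraph c d → ∀ y b, ZFSet.pair y b ∈ codingGraph c d →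
      (y ∈ x ∨ y = x) → ∀ q w, ZFSet.pair q w ∈ pairingSet p d → q = ZFSet.pair b a →
      w ∈ codeSet p c d A := by
    rintro x a hx y b hy hyx q w hq rfl
    obtain ⟨hx', rfl⟩ := mem_codingGraph.1 hx
    obtain ⟨hy', rfl⟩ := mem_codingGraph.1 hy
    obtain ⟨a, ha, b, hb, e, rfl⟩ := mem_pairingSet.1 hq
    rw [ZFSet.pair_inj, Ordinal.toZFSet_injective.eq_iff, Ordinal.toZFSet_injective.eq_iff] at e
    obtain ⟨rfl, rfl⟩ := e
    exact ZFSet.mem_sep.2 ⟨Ordinal.toZFSet_mem_toZFSet_iff.2 (hd _ ha _ hb),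
      .inl ⟨x, hx', y, hy', hyx, rfl⟩⟩
  exact (hk.iff ![codeSet p c d A, codingGraph c d, pairingSet p d] (fun v =>
    ∀ x a, ZFSet.pair x a ∈ v 1 → ∀ y b, ZFSet.pair y b ∈ v 1 →
      (y ∈ x ∨ y = x) → ∀ q w, ZFSet.pair q w ∈ v 2 → q = ZFSet.pair b a → w ∈ v 0)).2 h₀

/-- Codes of sets are positive, so p(0, c x) is never the code of a membership pair and speaks only
about A. -/
theorem mem_app_codeSet_iff (hp : IsPairing p) (hd : ∀ a < d, ∀ b < d, p a b < d)
    (hc : IsCoding c d) :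
    ∀ x a, ZFSet.pair x a ∈ k (codingGraph c d) → ∀ q w, ZFSet.pair q w ∈ k (pairingSet p d) →
      q = ZFSet.pair (k ∅) a → (w ∈ k (codeSet p c d A) ↔ x ∈ k A) := by
  have h₀ : ∀ x a, ZFSet.pair x a ∈ codingGraph c d → ∀ q w, ZFSet.pair q w ∈ pairingSet p d →
      q = ZFSet.pair ∅ a → (w ∈ codeSet p c d A ↔ x ∈ A) := by
    rintro x a hx q w hq rfl
    obtain ⟨hx, rfl⟩ := mem_codingGraph.1 hx
    obtain ⟨a, ha, b, hb, e, rfl⟩ := mem_pairingSet.1 hq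
    rw [← Ordinal.toZFSet_zero, ZFSet.pair_inj, Ordinal.toZFSet_injective.eq_iff,
      Ordinal.toZFSet_injective.eq_iff] at e
    obtain ⟨rfl, rfl⟩ := e
    constructor
    · intro h
      rcases (ZFSet.mem_sep.1 h).2 with ⟨x', hx', y, hy, -, e⟩ | ⟨x', hx', e⟩
      · exact ((hc.pos y).ne (hp.inj (Ordinal.toZFSet_injective e)).1).elim
      · rwa [hc.inj (hp.inj (Ordinal.toZFSet_injective e)).2]
    · intro h
      exact ZFSet.mem_sep.2 ⟨Ordinal.toZFSet_mem_toZFSet_iff.2 (hd _ ha _ hb),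
        .inr ⟨x, h, rfl⟩⟩
  exact (hk.iff ![codeSet p c d A, codingGraph c d, pairingSet p d, ∅, A] (fun v =>
    ∀ x a, ZFSet.pair x a ∈ v 1 → ∀ q w, ZFSet.pair q w ∈ v 2 →
      q = ZFSet.pair (v 3) a → (w ∈ v 0 ↔ x ∈ v 4))).2 h₀

theorem app_codingGraph_inj (hc : IsCoding c d) :
    ∀ x a, ZFSet.pair x a ∈ k (codingGraph c d) → ∀ y b, ZFSet.pair y b ∈ k (codingGraph c d) →
      (a = b ↔ x = y) := by
  have h₀ : ∀ x a, ZFSet.pair x a ∈ codingGraph c d → ∀ y b, ZFSet.pair y b ∈ codingGraph c d →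
      (a = b ↔ x = y) := by
    intro x a hx y b hy
    rw [← (mem_codingGraph.1 hx).2, ← (mem_codingGraph.1 hy).2,
      Ordinal.toZFSet_injective.eq_iff, hc.inj.eq_iff]
  exact (hk.iff ![codingGraph c d] (fun v => ∀ x a, ZFSet.pair x a ∈ v 0 → ∀ y b,
    ZFSet.pair y b ∈ v 0 → (a = b ↔ x = y))).2 h₀

theorem app_codingGraph_mem (hc : IsCoding c d) :
    ∀ x a, ZFSet.pair x a ∈ k (codingGraph c d) → k ∅ ∈ a ∧
      ∀ y ∈ x, ∃ y' b, ZFSet.pair y' b ∈ k (codingGraph c d) ∧ y' = y ∧ b ∈ a := by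
  have h₀ : ∀ x a, ZFSet.pair x a ∈ codingGraph c d → ∅ ∈ a ∧
      ∀ y ∈ x, ∃ y' b, ZFSet.pair y' b ∈ codingGraph c d ∧ y' = y ∧ b ∈ a := by
    intro x a hx
    obtain ⟨hx', rfl⟩ := mem_codingGraph.1 hx
    rw [← Ordinal.toZFSet_zero]
    refine ⟨Ordinal.toZFSet_mem_toZFSet_iff.2 (hc.pos x), fun y hy => ?_⟩
    exact ⟨y, _, mem_codingGraph.2 ⟨(ZFSet.isTransitive_vonNeumann d).mem_trans hy hx', rfl⟩, rfl,
      Ordinal.toZFSet_mem_toZFSet_iff.2 (hc.lt_of_mem x y hy)⟩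
  exact (hk.iff ![codingGraph c d, ∅] (fun v => ∀ x a, ZFSet.pair x a ∈ v 0 → v 1 ∈ a ∧
      ∀ y ∈ x, ∃ y' b, ZFSet.pair y' b ∈ v 0 ∧ y' = y ∧ b ∈ a)).2 h₀

/-- If the code of `V_ d` is fixed far enough, then so is the coding of small sets. -/
theorem pair_mem_app_codingGraph (hp : IsPairing p) (hd : ∀ a < d, ∀ b < d, p a b < d)
    (hc : IsCoding c d) (hA : A ⊆ V_ d) {l t : Ordinal.{u}} (hld : l ≤ d) (htd : t ≤ d)
    (hct : ∀ x ∈ V_ l, c x < t) (ht : t.toZFSet ∈ k d.toZFSet)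
    (hfix : ∀ a < p t t, a.toZFSet ∈ codeSet p c d A ↔ a.toZFSet ∈ k (codeSet p c d A)) :
    ∀ x ∈ V_ l, ZFSet.pair x (c x).toZFSet ∈ k (codingGraph c d) := by
  -- Primed facts are the same lemmas for the identity map, that is, in V itself.
  have hcases := app_codeSet_cases (p := p) hk hc hA
  have hcases' := app_codeSet_cases (p := p) (k := fun x => x) ⟨fun _ _ _ => Iff.rfl⟩ hc hA
  have hmem := mem_app_codeSet (A := A) (c := c) hk hd
  have hmem' := mem_app_codeSet (A := A) (c := c) (k := fun x => x) ⟨fun _ _ _ => Iff.rfl⟩ hd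
  have hinj := app_codingGraph_inj hk hc
  have hdown := app_codingGraph_mem hk hc
  have hpinj := hp.mem_app_inj (d := d) hk
  have hpinj' := hp.mem_app_inj (d := d) (k := fun x => x) ⟨fun _ _ _ => Iff.rfl⟩
  have hpk : ∀ a < t, ∀ b < t,
      ZFSet.pair (ZFSet.pair a.toZFSet b.toZFSet) (p a b).toZFSet ∈ k (pairingSet p d) :=
    fun a ha b hb => hp.pair_pair_mem_app hk (hk.mem_of_lt_of_mem ha.le ht)
      (hk.mem_of_lt_of_mem hb.le ht)
  have hpV : ∀ a < t, ∀ b < t,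
      ZFSet.pair (ZFSet.pair a.toZFSet b.toZFSet) (p a b).toZFSet ∈ pairingSet p d :=
    fun a ha b hb => pair_pair_mem_pairingSet (ha.trans_le htd) (hb.trans_le htd)
  have hcV : ∀ x ∈ V_ l, ZFSet.pair x (c x).toZFSet ∈ codingGraph c d := fun x hx =>
    mem_codingGraph.2 ⟨ZFSet.vonNeumann_subset_of_le hld hx, rfl⟩
  rw [hk.map_empty] at hcases hdown
  intro x
  induction x using ZFSet.inductionOn with
  | h x ih =>
  intro hx
  have ih' : ∀ y ∈ x, ZFSet.pair y (c y).toZFSet ∈ k (codingGraph c d) := fun y hy =>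
    ih y hy ((ZFSet.isTransitive_vonNeumann l).mem_trans hy hx)
  -- the ordinal `c x` is a code in the sense of the extension
  obtain ⟨x', hx'⟩ : ∃ x', ZFSet.pair x' (c x).toZFSet ∈ k (codingGraph c d) := by
    -- The code set contains the diagonal pairs y = x for this purpose: p(c x, c x) is transferred
    -- and shows that c x is a code even when x is empty.
    have hw := (hfix _ (hp.lt_of_lt (hct x hx) (hct x hx))).1
      (hmem' _ _ (hcV x hx) _ _ (hcV x hx) (.inr rfl) _ _ (hpV _ (hct x hx) _ (hct x hx)) rfl)
    rcases hcases _ hw with ⟨x', a, hx', y, b, -, -, hab⟩ | ⟨x', a, -, hab⟩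
    · have e := hpinj _ _ hab _ _ (hpk _ (hct x hx) _ (hct x hx)) rfl
      rw [ZFSet.pair_inj] at e
      exact ⟨x', e.2 ▸ hx'⟩
    · have e := hpinj _ _ hab _ _ (hpk _ (hct x hx) _ (hct x hx)) rfl
      rw [ZFSet.pair_inj, ← Ordinal.toZFSet_zero, Ordinal.toZFSet_injective.eq_iff] at e
      exact ((hc.pos x).ne e.1).elim
  -- An element of either set has a code below c x. Its membership code is transferred by `hfix`,
  -- and the induction hypothesis with injectivity of the coding identifies the decoded element.
  suffices x' = x from this ▸ hx'
  ext y
  constructor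
  · intro hy
    obtain ⟨_, b, hyb, rfl, hb⟩ := (hdown _ _ hx').2 y hy
    obtain ⟨b, hbc, rfl⟩ := Ordinal.mem_toZFSet_iff.1 hb
    have hbt := hbc.trans (hct x hx)
    have hw := (hfix _ (hp.lt_of_lt hbt (hct x hx))).2
      (hmem _ _ hx' _ _ hyb (.inl hy) _ _ (hpk _ hbt _ (hct x hx)) rfl)
    rcases hcases' _ hw with ⟨x₂, a₂, hx₂, y₂, b₂, hy₂, hyx₂, hab⟩ | ⟨x₂, a₂, -, hab⟩
    · have e := hpinj' _ _ hab _ _ (hpV _ hbt _ (hct x hx)) rfl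
      obtain ⟨rfl, rfl⟩ := ZFSet.pair_inj.1 e
      have e₁ : x₂ = x := hc.inj (Ordinal.toZFSet_injective (mem_codingGraph.1 hx₂).2)
      have e₂ : c y₂ = b := Ordinal.toZFSet_injective (mem_codingGraph.1 hy₂).2
      rcases hyx₂ with hyx₂ | hyx₂
      · rw [e₁] at hyx₂
        rwa [(hinj _ _ hyb _ _ (ih' _ hyx₂)).1 (by rw [e₂])]
      · rw [hyx₂, e₁] at e₂
        exact (hbc.ne e₂.symm).elim
    · have e := hpinj' _ _ hab _ _ (hpV _ hbt _ (hct x hx)) rfl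
      have h := (hdown _ _ hyb).1
      rw [← (ZFSet.pair_inj.1 e).1] at h
      exact (ZFSet.mem_irrefl _ h).elim
  · intro hy
    have hyt : c y < t := (hc.lt_of_mem x y hy).trans (hct x hx)
    have hyV := (ZFSet.isTransitive_vonNeumann l).mem_trans hy hx
    have hw := (hfix _ (hp.lt_of_lt hyt (hct x hx))).1
      (hmem' _ _ (hcV x hx) _ _ (hcV y hyV) (.inl hy) _ _ (hpV _ hyt _ (hct x hx)) rfl)
    rcases hcases _ hw with ⟨x₁, a₁, hx₁, y₁, b₁, hy₁, hyx₁, hab⟩ | ⟨x₁, a₁, -, hab⟩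
    · have e := hpinj _ _ hab _ _ (hpk _ hyt _ (hct x hx)) rfl
      obtain ⟨rfl, rfl⟩ := ZFSet.pair_inj.1 e
      obtain rfl := (hinj _ _ hx₁ _ _ hx').1 rfl
      obtain rfl := (hinj _ _ hy₁ _ _ (ih' y hy)).1 rfl
      refine hyx₁.resolve_right fun e => ?_
      have := (hinj _ _ hy₁ _ _ hx₁).2 e
      exact ((hc.lt_of_mem x _ hy).ne (Ordinal.toZFSet_injective this)).elim
    · have e := hpinj _ _ hab _ _ (hpk _ hyt _ (hct x hx)) rfl
      rw [ZFSet.pair_inj, ← Ordinal.toZFSet_zero, Ordinal.toZFSet_injective.eq_iff] at e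
      exact ((hc.pos y).ne e.1).elim

end Coding

theorem strong_of_strongCompactFor {δ : Cardinal.{u}} (hδ : Cardinal.aleph0 ≤ δ)
    (h : ∀ A : ZFSet.{u}, A ⊆ δ.ord.toZFSet →
      ∃ κ : Cardinal.{u}, κ < δ ∧ IsLTStronglyCompactFor κ δ A)
    {A : ZFSet.{u}} (hA : A ⊆ V_ δ.ord) :
    ∃ κ : Cardinal.{u}, κ < δ ∧ IsLTStronglyCompact κ δ ∧ IsLTStrongFor κ δ A := by
  have hlim := Cardinal.isSuccLimit_ord hδ
  obtain ⟨p, hp⟩ := exists_isPairing.{u}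
  obtain ⟨c₀, hinj, hmono, hcard⟩ := exists_ranked_coding.{u}
  -- The shift frees 0 to serve as the tag for A.
  set c : ZFSet.{u} → Ordinal.{u} := fun x => c₀ x + 1 with hcdef
  have hpd : ∀ a < δ.ord, ∀ b < δ.ord, p a b < δ.ord := fun a ha b hb => hp.lt_ord hδ ha hb
  have hbound : ∀ l < δ.ord, ∃ t < δ.ord, ∀ x ∈ V_ l, c x < t := by
    intro l hl
    obtain ⟨μ, hμ, hlμ, hV⟩ := exists_card_vonNeumann_lt hδ h hl
    refine ⟨μ.ord + 1, hlim.add_one_lt (Cardinal.ord_lt_ord.2 hμ), fun x hx => ?_⟩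
    rw [Order.lt_add_one_iff, hcdef, Order.add_one_le_iff, Cardinal.lt_ord]
    refine (hcard x).trans_lt (hV _ (lt_of_le_of_lt ?_ hlμ))
    exact Order.add_one_le_of_lt (ZFSet.mem_vonNeumann.1 hx)
  have hc : IsCoding c δ.ord := by
    refine ⟨fun x y e => hinj (Order.succ_injective e), fun x y hy => ?_, fun x => ?_,
      fun x hx => ?_⟩
    · exact Order.succ_lt_succ (hmono y x (ZFSet.rank_lt_of_mem hy))
    · exact lt_of_le_of_lt zero_le (lt_add_one (c₀ x))
    · obtain ⟨t, ht, hct⟩ := hbound _ (hlim.add_one_lt (ZFSet.mem_vonNeumann.1 hx))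
      exact (hct x (ZFSet.mem_vonNeumann.2 (lt_add_one _))).trans ht
  obtain ⟨κ, hκ, hsc⟩ := h (codeSet p c δ.ord A) ZFSet.sep_subset
  refine ⟨κ, hκ, fun l hl hlδ => ?_, fun l hl hlδ => ?_⟩
  · obtain ⟨j, ⟨hjc, hjl, hcov⟩, -⟩ := hsc l hl hlδ
    exact ⟨j, hjc, hjl, hcov.weakCovering⟩
  · obtain ⟨t, htδ, hct⟩ := hbound l hlδ
    -- The maximum secures j(κ) > l, puts t into j(κ) so that pairing is absolute below t, and
    -- reaches p t t, which bounds all codes of pairs below t.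
    obtain ⟨j, ⟨hjc, hjm, -⟩, hfix⟩ := hsc (max (max l t) (p t t))
      (hl.trans ((le_max_left _ _).trans (le_max_left _ _)))
      (max_lt (max_lt hlδ htδ) (hpd t htδ t htδ))
    have hj := j.preservesAbsolute
    rw [inter_toZFSet_eq_iff] at hfix
    have hjl := hj.mem_of_lt_of_mem ((le_max_left _ _).trans (le_max_left _ _)) hjm
    have hjt := hj.mem_of_lt_of_mem ((le_max_right _ _).trans (le_max_left _ _)) hjm
    have hjt' : t.toZFSet ∈ j.app δ.ord.toZFSet :=
      hj.subset_iff.2 (Ordinal.toZFSet_monotone (Cardinal.ord_le_ord.2 hκ.le)) hjt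
    have hfix' : ∀ a < p t t, a.toZFSet ∈ codeSet p c δ.ord A ↔
        a.toZFSet ∈ j.app (codeSet p c δ.ord A) := fun a ha =>
      hfix a (ha.trans_le (le_max_right _ _))
    have main := pair_mem_app_codingGraph hj hp hpd hc hA hlδ.le htδ.le hct hjt' hfix'
    have hAV : ∀ x ∈ V_ l, x ∈ A ↔ x ∈ j.app A := by
      intro x hx
      have ht0 : 0 < t := zero_le.trans_lt (hct x hx)
      have e₁ := mem_app_codeSet_iff (A := A) (k := fun x => x) ⟨fun _ _ _ => Iff.rfl⟩ hp hpd hc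
        x _ (mem_codingGraph.2 ⟨ZFSet.vonNeumann_subset_of_le hlδ.le hx, rfl⟩) _ _
        (pair_pair_mem_pairingSet (ht0.trans htδ) ((hct x hx).trans htδ))
        (by rw [Ordinal.toZFSet_zero])
      have e₂ := mem_app_codeSet_iff (A := A) hj hp hpd hc x _ (main x hx) _ _
        (hp.pair_pair_mem_app hj (hj.mem_of_lt_of_mem ht0.le hjt')
          (hj.mem_of_lt_of_mem (hct x hx).le hjt'))
        (by rw [Ordinal.toZFSet_zero, hj.map_empty])
      rw [← e₁, ← e₂]
      exact hfix' _ (hp.lt_of_lt ht0 (hct x hx))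
    refine ⟨j, ⟨hjc, hjl, fun x hx => ?_⟩, ?_⟩
    -- The pair (x, c x) belongs to j of the coding function, so transitivity of the target yields
    -- x.
    · have h₁ := j.transitive _ (j.app_mem _) _ (main x hx)
      have h₂ := j.transitive _ h₁ {x} (by rw [ZFSet.pair, ZFSet.mem_pair]; exact .inl rfl)
      exact j.transitive _ h₂ x (ZFSet.mem_singleton.2 rfl)
    · ext x
      simp only [ZFSet.mem_inter, and_congr_left_iff]
      exact hAV x

end WoodinSC

theorem proposition3p3 (δ : Cardinal.{u}) (hδ : Cardinal.aleph0 ≤ δ) :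
    List.TFAE [
      ∀ A : ZFSet.{u}, A ⊆ δ.ord.toZFSet →
        ∃ κ : Cardinal.{u}, κ < δ ∧ WoodinSC.IsLTStronglyCompactFor κ δ A,
      ∀ A₁ A₂ : ZFSet.{u}, A₁ ⊆ δ.ord.toZFSet → A₂ ⊆ δ.ord.toZFSet →
        ∃ κ : Cardinal.{u}, κ < δ ∧ WoodinSC.IsLTStronglyCompactForPair κ δ A₁ A₂,
      ∀ A : ZFSet.{u}, A ⊆ ZFSet.vonNeumann δ.ord →
        ∃ κ : Cardinal.{u}, κ < δ ∧
          WoodinSC.IsLTStronglyCompact κ δ ∧ WoodinSC.IsLTStrongFor κ δ A] := by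
  tfae_have 1 → 3 := fun h A hA => WoodinSC.strong_of_strongCompactFor hδ h hA
  tfae_have 3 → 2 := fun h A₁ A₂ h₁ h₂ => WoodinSC.strongCompactForPair_of_strong hδ h h₁ h₂
  tfae_have 2 → 1 := fun h A hA =>
    (h A A hA hA).imp fun κ hκ => ⟨hκ.1, WoodinSC.strongCompactFor_of_pair hδ hκ.2⟩
  tfae_finish
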